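/- **Theorem (spectral representation of the hidden variables).** Let $\Omega$ be a (possibly unbounded) self-adjoint operator in a complex Hilbert space $\mathcal H$, and let $\mathcal H=H_1\oplus H_2$ be an orthogonal splitting into closed subspaces with respect to which $$\Omega=\begin{bmatrix}\Omega_1&\Gamma\\ \Gamma^\dagger&\Omega_2\end{bmatrix},$$ with a bounded operator $\Gamma:H_2\to H_1$; that is, the domain of $\Omega$ is invariant under the orthogonal projection $P_1$ onto $H_1$, $\Omega_2$ is the compression of $\Omega$ to $H_2$ (with domain $\mathrm{Dom}\,\Omega\cap H_2$), and $\Gamma x=P_1\Omega x$ for $x\in\mathrm{Dom}\,\Omega\cap H_2$. For a self-adjoint operator $T$ and a set $S$ of vectors let $\mathcal O_T(S)$ be the closed linear span of $\{f(T)w: f\in C_c(\mathbb R),\ w\in S\}$. Let $\mathcal H_{\min}=\mathcal O_\Omega(H_1)$ be the state space of the minimal conservative extension within $(\mathcal H,\Omega)$ of the open system obtained by projecting the dynamics onto $H_1$, and let $H_{2c}=\mathcal H_{\min}\ominus H_1\subseteq H_2$. An operator has pure point spectrum if its eigenvectors span a dense subspace. 1. If $\Omega_2$ has pure point spectrum,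 then $$H_{2c}=\mathcal O_{\Omega_2}(\mathrm{Ran}\,\Gamma^\dagger)=\bigoplus_\alpha \pi_{2\alpha}(\mathrm{Ran}\,\Gamma^\dagger),$$ where $\pi_{2\alpha}$ are the orthogonal projections in $H_2$ onto the eigenspaces of $\Omega_2$; the right-hand side is the closure of the linear span of the mutually orthogonal subspaces $\pi_{2\alpha}(\mathrm{Ran}\,\Gamma^\dagger)$. 2. In general, $\Omega_2$ has a spectral resolution of the identity, i.e. a projection-valued Borel measure $E_2$ on $\mathbb R$ with $f(\Omega_2)=\int f\,dE_2$ for all $f\in C_c(\mathbb R)$, and for it $H_{2c}$ is the closure of the linear span of the subspaces $E_2(\Delta)(\mathrm{Ran}\,\Gamma^\dagger)$, $\Delta$ an interval of $\mathbb R$. For every $\varepsilon>0$ the same holds if only intervals $\Delta$ contained in some interval of length $\varepsilon$ are used. 3. If $\Omega_2$ has pure point spectrum, then $H_{2c}=H_2$ if and only if $\Gamma\phi\neq0$ for every eigenmode (eigenvector) $\phi$ of $\Omega_2$. -/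

import Mathlib

open scoped InnerProductSpace

namespace OpenSystem

noncomputable section

variable {H : Type*} [NormedAddCommGroup H] [InnerProductSpace ℂ H]

/-- The bounded operator `R` is the inverse of `T - z`, where `T` is a (possibly unbounded)
operator: `R` maps `H` onto the domain of `T`, and `x = R y` if and only if `(T - z) x = y`. -/
def IsResolventAt (T : H →ₗ.[ℂ] H) (z : ℂ) (R : H →L[ℂ] H) : Prop :=
  ∀ x y : H, R y = x ↔ ∃ hx : x ∈ T.domain, T ⟨x, hx⟩ - z • x = y

open scoped Classical in
/-- The resolvent `(T - z)⁻¹` (zero if `T - z` has no bounded everywhere defined inverse,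
which does not happen for self-adjoint `T` and non-real `z`). -/
def resolventOp (T : H →ₗ.[ℂ] H) (z : ℂ) : H →L[ℂ] H :=
  if h : ∃ R : H →L[ℂ] H, IsResolventAt T z R then h.choose else 0

/-- The function `g` of the variable `z = (x - i)⁻¹` that corresponds to the function `f` of the
real variable `x`: `g ((x - i)⁻¹) = f x`, and `g 0 = 0` is the value of `f` at infinity. -/
def resolventSymbol (f : ℝ → ℂ) (z : ℂ) : ℂ :=
  if z = 0 then 0 else f (z⁻¹).re

/-- The operator `f(T)` of the continuous functional calculus of a self-adjoint operator `T`, for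
a continuous function `f` with compact support: it is `g(R)` for the bounded normal operator
`R = (T - i)⁻¹` and the function `g` with `g ((x - i)⁻¹) = f x` for real `x` and `g 0 = 0`. -/
def funCalc [CompleteSpace H] (T : H →ₗ.[ℂ] H) (f : ℝ → ℂ) : H →L[ℂ] H :=
  cfc (resolventSymbol f) (resolventOp T Complex.I)

/-- The closed orbit of the set `S` under the action of `T`: the closed linear span of the vectors
`f(T) w`, where `f` is continuous with compact support and `w ∈ S`. -/
def orbit [CompleteSpace H] (T : H →ₗ.[ℂ] H) (S : Set H) : Submodule ℂ H :=
  (Submodule.span ℂ {x : H | ∃ f : ℝ → ℂ, Continuous f ∧ HasCompactSupport f ∧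
    ∃ w ∈ S, x = funCalc T f w}).topologicalClosure

/-- The eigenspace of the operator `T` for the value `z` (zero if `z` is not an eigenvalue). -/
def eigenspace (T : H →ₗ.[ℂ] H) (z : ℂ) : Submodule ℂ H where
  carrier := {x | ∃ hx : x ∈ T.domain, T ⟨x, hx⟩ = z • x}
  zero_mem' := ⟨T.domain.zero_mem, by
    rw [smul_zero]; exact T.map_zero⟩
  add_mem' := by
    rintro x y ⟨hx, hTx⟩ ⟨hy, hTy⟩
    refine ⟨T.domain.add_mem hx hy, ?_⟩
    have h : T (⟨x, hx⟩ + ⟨y, hy⟩) = T ⟨x, hx⟩ + T ⟨y, hy⟩ := T.map_add _ _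
    rw [hTx, hTy, ← smul_add] at h
    exact h
  smul_mem' := by
    rintro c x ⟨hx, hTx⟩
    refine ⟨T.domain.smul_mem c hx, ?_⟩
    have h : T (c • ⟨x, hx⟩) = c • T ⟨x, hx⟩ := T.map_smul _ _
    rw [hTx, smul_comm] at h
    exact h

/-- The orthogonal projection onto the eigenspace of `T` for the value `z`. (The eigenspaces of a
self-adjoint operator are closed, so that the closure changes nothing for them.) -/
def eigenProj [CompleteSpace H] (T : H →ₗ.[ℂ] H) (z : ℂ) : H →L[ℂ] H :=
  (eigenspace T z).topologicalClosure.starProjection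

/-- An eigenmode of `T` is an eigenvector of `T`. -/
def IsEigenmode (T : H →ₗ.[ℂ] H) (φ : H) : Prop :=
  φ ≠ 0 ∧ ∃ z : ℂ, φ ∈ eigenspace T z

/-- `T` has pure point spectrum: the space is the closed linear span of the eigenspaces of `T`. -/
def HasPurePointSpectrum (T : H →ₗ.[ℂ] H) : Prop :=
  (⨆ z : ℂ, eigenspace T z).topologicalClosure = ⊤

/-- A projection-valued Borel measure on the real line, as a function on sets whose values matter
on Borel sets only: an orthogonal projection `E B` for each Borel set `B`, with `E ℝ = 1` and
countably additive in the strong operator topology. -/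
structure ProjectionValuedMeasure (H : Type*) [NormedAddCommGroup H] [InnerProductSpace ℂ H]
    [CompleteSpace H] where
  proj : Set ℝ → H →L[ℂ] H
  isStarProjection : ∀ B : Set ℝ, MeasurableSet B → IsStarProjection (proj B)
  proj_empty : proj ∅ = 0
  proj_univ : proj Set.univ = 1
  proj_inter : ∀ A B : Set ℝ, MeasurableSet A → MeasurableSet B →
    proj (A ∩ B) = proj A * proj B
  hasSum_proj : ∀ B : ℕ → Set ℝ, (∀ n, MeasurableSet (B n)) →
    Pairwise (fun m n => Disjoint (B m) (B n)) →
    ∀ v : H, HasSum (fun n => proj (B n) v) (proj (⋃ n, B n) v)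

/-- The finite positive measure `B ↦ ⟪v, E(B) v⟫` on the real line. -/
def ProjectionValuedMeasure.measure [CompleteSpace H] (E : ProjectionValuedMeasure H) (v : H) :
    MeasureTheory.Measure ℝ :=
  MeasureTheory.Measure.ofMeasurable (fun B _ => ENNReal.ofReal (⟪v, E.proj B v⟫_ℂ).re)
    (by simp [E.proj_empty])
    (by
      intro B hB hd
      have hs : HasSum (fun n => (⟪v, E.proj (B n) v⟫_ℂ).re) (⟪v, E.proj (⋃ n, B n) v⟫_ℂ).re :=
        Complex.hasSum_re (((innerSL ℂ v).hasSum (E.hasSum_proj B hB hd v)))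
      have hn : ∀ n, 0 ≤ (⟪v, E.proj (B n) v⟫_ℂ).re := fun n => by
        have h := (ContinuousLinearMap.IsPositive.of_isStarProjection
          (E.isStarProjection (B n) (hB n))).re_inner_nonneg_right v
        simpa using h
      rw [← hs.tsum_eq, ENNReal.ofReal_tsum_of_nonneg hn hs.summable])

/-- `E` is the spectral resolution of the identity for the self-adjoint operator `T`:
`f(T) = ∫ f dE` for each continuous function `f` with compact support. The operator on the right
is determined by its quadratic form `v ↦ ∫ f d⟪v, E v⟫`. -/
def IsSpectralResolution [CompleteSpace H] (T : H →ₗ.[ℂ] H) (E : ProjectionValuedMeasure H) :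
    Prop :=
  ∀ f : ℝ → ℂ, Continuous f → HasCompactSupport f →
    ∀ v : H, ⟪v, funCalc T f v⟫_ℂ = ∫ x, f x ∂(E.measure v)

/-- The compression of the operator `T` to the subspace `K`: its domain consists of the vectors of
`K` in the domain of `T`, and it maps `x` to the orthogonal projection of `T x` onto `K`. For a
block operator matrix on `K ⊕ Kᗮ` these are the diagonal entries. -/
def compression (T : H →ₗ.[ℂ] H) (K : Submodule ℂ H) [K.HasOrthogonalProjection] :
    K →ₗ.[ℂ] K where
  domain := T.domain.comap K.subtype
  toFun := (K.orthogonalProjectionOnto : H →ₗ[ℂ] K) ∘ₗ T.toFun ∘ₗ K.subtype.submoduleComap T.domain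

/-- With respect to the splitting `H = H₁ ⊕ H₁ᗮ`, the self-adjoint operator `T` is a block operator
matrix with the bounded off-diagonal entry `Γ : H₁ᗮ → H₁`: the domain of `T` splits, and `Γ x` is
the component of `T x` in `H₁` for `x ∈ H₁ᗮ` in the domain. (By symmetry of `T` the other
off-diagonal entry is then the adjoint of `Γ`.) -/
structure HasBoundedCoupling (T : H →ₗ.[ℂ] H) (H₁ : Submodule ℂ H) [H₁.HasOrthogonalProjection]
    (Γ : H₁ᗮ →L[ℂ] H₁) : Prop where
  proj_mem_domain : ∀ x ∈ T.domain, H₁.starProjection x ∈ T.domain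
  coupling_apply : ∀ (x : H₁ᗮ) (hx : (x : H) ∈ T.domain),
    Γ x = H₁.orthogonalProjectionOnto (T ⟨x, hx⟩)

/-- The state space of the minimal conservative extension, within `(H, T)`, of the open system
obtained by projecting the dynamics of `(H, T)` to `H₁`. -/
def minimalExtension [CompleteSpace H] (T : H →ₗ.[ℂ] H) (H₁ : Submodule ℂ H) : Submodule ℂ H :=
  orbit T (H₁ : Set H)

/-- The coupled component of the space `H₁ᗮ` of hidden variables: the orthogonal complement of `H₁`
in the state space of the minimal conservative extension, as a subspace of `H₁ᗮ`. -/
def coupledComponent [CompleteSpace H] (T : H →ₗ.[ℂ] H) (H₁ : Submodule ℂ H) :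
    Submodule ℂ H₁ᗮ :=
  (minimalExtension T H₁).comap H₁ᗮ.subtype

end

end OpenSystem

/-! The heart is the identity `coupledComponent_eq`: H_2c is the orbit of Ran Γ† under Ω₂. After it,
only the one operator Ω₂ and the one subspace Ran Γ† matter. An orbit is the smallest closed
subspace that contains the given vectors and reduces T (`subset_orbit`, `reduces_orbit`,
`orbit_le`), and reducing T means that the projection commutes with (T - i)⁻¹
(`reduces_iff_commute`). So orbits are compared by exhibiting reducing subspaces. If K₂ reduces Ω₂
and contains Ran Γ†, then Γ vanishes on K₂ᗮ, and H₁ ⊕ K₂ reduces Ω. Conversely, if K ⊇ H₁ reduces Ω,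
then K ∩ H₂ reduces Ω₂ and contains Γ†u = Ωu - P₁Ωu for u in a dense part of H₁, hence all of Ran
Γ†. That Ω₂ is self-adjoint follows from the boundedness of Γ.

For pure point spectrum (`orbit_eq_of_hasPurePointSpectrum`), resolvents act on eigenvectors as
scalars, so the closed span of the eigenprojections of R reduces T. It contains R because a vector
killed by all eigenprojections is zero. In the criterion, Γφ = 0 for an eigenmode φ says exactly
that φ is orthogonal to the orbit.

For general spectrum, the spectral resolution is built from the functional calculus: Riesz-Markov
gives a measure for each vector v, the map f ↦ f(T)v is isometric into H from L² of that measure,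
and it extends to indicators. For an arbitrary resolution E, `IsSpectralResolution.orbit_eq` shows
that closed subspaces invariant under C_c functions of T and those invariant under E serve equally
well; a π-λ argument reduces Borel sets to short intervals. -/

namespace OpenSystem

/-! ### Resolvents of a self-adjoint operator. -/

section Resolvent

variable {H : Type*} [NormedAddCommGroup H] [InnerProductSpace ℂ H]

/-- The graph is a subspace of H × H, so this form avoids carrying domain proofs through linear
algebra. -/
theorem isResolventAt_iff_mem_graph {T : H →ₗ.[ℂ] H} {z : ℂ} {R : H →L[ℂ] H} :
    IsResolventAt T z R ↔ ∀ x y : H, R y = x ↔ (x, y + z • x) ∈ T.graph := by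
  refine forall₂_congr fun x y => iff_congr Iff.rfl ?_
  rw [LinearPMap.mem_graph_iff]
  constructor
  · rintro ⟨hx, h⟩
    exact ⟨⟨x, hx⟩, rfl, by simp [← h]⟩
  · rintro ⟨⟨x', hx⟩, rfl, h⟩
    exact ⟨hx, by simp [h]⟩

theorem IsResolventAt.mem_eigenspace_iff {T : H →ₗ.[ℂ] H} {z : ℂ} {R : H →L[ℂ] H}
    (hR : IsResolventAt T z R) {w : ℂ} {x : H} : x ∈ eigenspace T w ↔ R ((w - z) • x) = x := by
  rw [hR]
  change (∃ hx : x ∈ T.domain, T ⟨x, hx⟩ = w • x) ↔ _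
  refine exists_congr fun hx => ?_
  rw [sub_smul, sub_left_inj]

theorem IsResolventAt.isClosed_eigenspace {T : H →ₗ.[ℂ] H} {z : ℂ} {R : H →L[ℂ] H}
    (hR : IsResolventAt T z R) (w : ℂ) : IsClosed (eigenspace T w : Set H) := by
  have : (eigenspace T w : Set H) = {x | R ((w - z) • x) = x} :=
    Set.ext fun x => hR.mem_eigenspace_iff
  rw [this]
  exact isClosed_eq (by fun_prop) (by fun_prop)

theorem IsResolventAt.apply_of_mem_eigenspace {T : H →ₗ.[ℂ] H} {z : ℂ} {R : H →L[ℂ] H}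
    (hR : IsResolventAt T z R) {w : ℂ} {x : H} (hx : x ∈ eigenspace T w) :
    R x = (w - z)⁻¹ • x := by
  rw [hR.mem_eigenspace_iff, map_smul] at hx
  by_cases h : w - z = 0
  · rw [h, zero_smul] at hx
    simp [← hx]
  · rw [eq_inv_smul_iff₀ h, hx]

variable [CompleteSpace H] {T : H →ₗ.[ℂ] H}

theorem inner_apply_eq_of_isSelfAdjoint (hT : IsSelfAdjoint T) (x y : T.domain) :
    ⟪T x, (y : H)⟫_ℂ = ⟪(x : H), T y⟫_ℂ := by
  have h := LinearPMap.adjoint_isFormalAdjoint hT.dense_domain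
  rw [LinearPMap.isSelfAdjoint_def.1 hT] at h
  exact h x y

theorem inner_eq_of_mem_graph (hT : IsSelfAdjoint T) {x x' y y' : H} (hx : (x, x') ∈ T.graph)
    (hy : (y, y') ∈ T.graph) : ⟪x', y⟫_ℂ = ⟪x, y'⟫_ℂ := by
  rw [LinearPMap.mem_graph_iff] at hx hy
  obtain ⟨a, rfl, rfl⟩ := hx
  obtain ⟨b, rfl, rfl⟩ := hy
  exact inner_apply_eq_of_isSelfAdjoint hT a b

theorem mem_graph_of_isSelfAdjoint (hT : IsSelfAdjoint T) {y w : H}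
    (h : ∀ x : T.domain, ⟪w, (x : H)⟫_ℂ = ⟪y, T x⟫_ℂ) : (y, w) ∈ T.graph := by
  have hy : y ∈ T.adjoint.domain := LinearPMap.mem_adjoint_domain_of_exists y ⟨w, h⟩
  rw [← LinearPMap.isSelfAdjoint_def.1 hT, LinearPMap.mem_graph_iff]
  exact ⟨⟨y, hy⟩, rfl, LinearPMap.adjoint_apply_eq hT.dense_domain ⟨y, hy⟩ h⟩

/-- Symmetry makes the adjoint an extension of T, and `hm` says that it has no larger domain. -/
theorem isSelfAdjoint_of_symmetric_of_maximal (hd : Dense (T.domain : Set H))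
    (hs : ∀ x y : T.domain, ⟪T x, (y : H)⟫_ℂ = ⟪(x : H), T y⟫_ℂ)
    (hm : ∀ y w : H, (∀ x : T.domain, ⟪w, (x : H)⟫_ℂ = ⟪y, T x⟫_ℂ) → y ∈ T.domain) :
    IsSelfAdjoint T := by
  rw [LinearPMap.isSelfAdjoint_def]
  refine (LinearPMap.eq_of_le_of_domain_eq (LinearPMap.IsFormalAdjoint.le_adjoint hd hs) ?_).symm
  refine le_antisymm (LinearPMap.IsFormalAdjoint.le_adjoint hd hs).1 fun y hy => ?_
  exact hm y (T.adjoint ⟨y, hy⟩) fun x => LinearPMap.adjoint_isFormalAdjoint hd ⟨y, hy⟩ x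

/-- Since ⟪x, Tx⟫ is real, the imaginary part of ⟪x, (T - z)x⟫ is -(Im z)‖x‖²; Cauchy-Schwarz does
the rest. -/
theorem abs_im_mul_norm_le (hT : IsSelfAdjoint T) (z : ℂ) {x y : H} (hx : (x, y) ∈ T.graph) :
    |z.im| * ‖x‖ ≤ ‖y - z • x‖ := by
  have h0 : (⟪x, y⟫_ℂ).im = 0 := by
    have h1 := inner_conj_symm (𝕜 := ℂ) x y
    rw [inner_eq_of_mem_graph hT hx hx] at h1
    exact Complex.conj_eq_iff_im.1 h1
  have h1 : (⟪x, y - z • x⟫_ℂ).im = -(z.im * ‖x‖ ^ 2) := by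
    rw [inner_sub_right, inner_smul_right, inner_self_eq_norm_sq_to_K, Complex.sub_im, h0]
    simp [Complex.mul_im, ← Complex.ofReal_pow]
  have h2 : |z.im| * ‖x‖ * ‖x‖ ≤ ‖y - z • x‖ * ‖x‖ := by
    calc |z.im| * ‖x‖ * ‖x‖ = |(⟪x, y - z • x⟫_ℂ).im| := by
          rw [h1, abs_neg, abs_mul, abs_of_nonneg (sq_nonneg ‖x‖)]; ring
      _ ≤ ‖⟪x, y - z • x⟫_ℂ‖ := Complex.abs_im_le_norm _
      _ ≤ ‖x‖ * ‖y - z • x‖ := norm_inner_le_norm _ _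
      _ = _ := mul_comm _ _
  rcases (norm_nonneg x).eq_or_lt with h | h
  · rw [← h, mul_zero]
    exact norm_nonneg _
  · exact le_of_mul_le_mul_right h2 h

/-- On the closed graph, T - z is a bounded operator that is bounded below, so its range is closed.
A vector orthogonal to the range is an eigenvector for the conjugate of z, or zero, and the same
lower bound excludes the former. -/
theorem exists_isResolventAt (hT : IsSelfAdjoint T) {z : ℂ} (hz : z.im ≠ 0) :
    ∃ R : H →L[ℂ] H, IsResolventAt T z R := by
  have hcl : IsClosed (T.graph : Set (H × H)) := hT.isClosed
  have : CompleteSpace T.graph := hcl.completeSpace_coe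
  let F : T.graph →L[ℂ] H :=
    (ContinuousLinearMap.snd ℂ H H - z • ContinuousLinearMap.fst ℂ H H) ∘L T.graph.subtypeL
  have hF : ∀ p : T.graph, F p = p.1.2 - z • p.1.1 := fun p => rfl
  have hz' : 0 < |z.im| := abs_pos.2 hz
  have hbound : ∀ p : T.graph, ‖p‖ ≤ (1 + (1 + ‖z‖) * |z.im|⁻¹) * ‖F p‖ := by
    rintro ⟨⟨x, y⟩, hp⟩
    have h1 := abs_im_mul_norm_le hT z hp
    rw [hF]
    change max ‖x‖ ‖y‖ ≤ _ * ‖y - z • x‖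
    have h2 : ‖x‖ ≤ |z.im|⁻¹ * ‖y - z • x‖ := by rwa [le_inv_mul_iff₀ hz']
    have h3 : ‖y‖ ≤ ‖y - z • x‖ + ‖z‖ * ‖x‖ := by
      rw [← norm_smul]
      simpa using norm_add_le (y - z • x) (z • x)
    have h4 := mul_le_mul_of_nonneg_left h2 (norm_nonneg z)
    have h5 := norm_nonneg (y - z • x)
    have h6 := norm_nonneg x
    have h7 := mul_nonneg (norm_nonneg z) h6
    have h8 := mul_nonneg (norm_nonneg z) (h6.trans h2)
    refine max_le ?_ ?_ <;> linarith
  have hinj : LinearMap.ker F.toLinearMap = ⊥ := by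
    rw [LinearMap.ker_eq_bot']
    intro p hp
    have h := hbound p
    rw [show F p = 0 from hp, norm_zero, mul_zero] at h
    exact norm_le_zero_iff.1 h
  have hclosed : IsClosed (LinearMap.range F.toLinearMap : Set H) := by
    have ha : AntilipschitzWith (1 + (1 + ‖z‖) * |z.im|⁻¹).toNNReal F :=
      F.antilipschitz_of_bound fun p => by
        rw [Real.coe_toNNReal _ (by positivity)]
        exact hbound p
    exact ha.isClosed_range F.uniformContinuous
  have hsurj : LinearMap.range F.toLinearMap = ⊤ := by
    have : CompleteSpace (LinearMap.range F.toLinearMap) := hclosed.completeSpace_coe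
    rw [← Submodule.orthogonal_eq_bot_iff, Submodule.eq_bot_iff]
    intro y hy
    have hg : (y, (starRingEnd ℂ z) • y) ∈ T.graph := by
      refine mem_graph_of_isSelfAdjoint hT fun x => ?_
      have h := Submodule.inner_left_of_mem_orthogonal
        (LinearMap.mem_range_self F.toLinearMap ⟨_, T.mem_graph x⟩) hy
      change ⟪y, T x - z • (x : H)⟫_ℂ = 0 at h
      rw [inner_sub_right, inner_smul_right, sub_eq_zero] at h
      rw [h, inner_smul_left, Complex.conj_conj]
    have h := abs_im_mul_norm_le hT (starRingEnd ℂ z) hg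
    rw [sub_self, norm_zero, Complex.conj_im, abs_neg] at h
    exact norm_le_zero_iff.1 (nonpos_of_mul_nonpos_right h hz')
  let e := ContinuousLinearEquiv.ofBijective F hinj hsurj
  refine ⟨ContinuousLinearMap.fst ℂ H H ∘L T.graph.subtypeL ∘L
    (e.symm : H →L[ℂ] T.graph), isResolventAt_iff_mem_graph.2 fun x y => ?_⟩
  constructor
  · rintro rfl
    have h1 : F (e.symm y) = y := e.apply_symm_apply y
    rw [hF] at h1
    have h2 := (e.symm y).2
    convert h2 using 1
    refine Prod.ext rfl ?_
    rw [eq_comm, ← sub_eq_iff_eq_add]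
    exact h1
  · intro h
    have h1 : e ⟨_, h⟩ = y := by
      change F ⟨_, h⟩ = y
      rw [hF]
      simp
    change (e.symm y).1.1 = x
    rw [← h1, e.symm_apply_apply]

theorem isResolventAt_resolventOp (hT : IsSelfAdjoint T) {z : ℂ} (hz : z.im ≠ 0) :
    IsResolventAt T z (resolventOp T z) := by
  have h := exists_isResolventAt hT hz
  rw [resolventOp, dif_pos h]
  exact h.choose_spec

theorem resolventOp_mem_graph (hT : IsSelfAdjoint T) {z : ℂ} (hz : z.im ≠ 0) (y : H) :
    (resolventOp T z y, y + z • resolventOp T z y) ∈ T.graph :=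
  (isResolventAt_iff_mem_graph.1 (isResolventAt_resolventOp hT hz) _ _).1 rfl

theorem adjoint_resolventOp (hT : IsSelfAdjoint T) {z : ℂ} (hz : z.im ≠ 0) :
    ContinuousLinearMap.adjoint (resolventOp T z) = resolventOp T (starRingEnd ℂ z) := by
  symm
  rw [ContinuousLinearMap.eq_adjoint_iff]
  intro x y
  have hz' : (starRingEnd ℂ z).im ≠ 0 := by simpa using hz
  have h := inner_eq_of_mem_graph hT (resolventOp_mem_graph hT hz' x) (resolventOp_mem_graph hT hz y)
  simp only [inner_add_left, inner_add_right, inner_smul_left, inner_smul_right,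
    Complex.conj_conj] at h
  exact (add_right_cancel h).symm

theorem resolventOp_sub (hT : IsSelfAdjoint T) {z w : ℂ} (hz : z.im ≠ 0) (hw : w.im ≠ 0) :
    resolventOp T z - resolventOp T w = (z - w) • (resolventOp T z * resolventOp T w) := by
  ext y
  -- T - z = (T - w) - (z - w), applied to the vector (T - w)⁻¹ y.
  have h : resolventOp T z (y - (z - w) • resolventOp T w y) = resolventOp T w y := by
    rw [isResolventAt_iff_mem_graph.1 (isResolventAt_resolventOp hT hz)]
    convert resolventOp_mem_graph hT hw y using 2
    module
  rw [map_sub, map_smul, sub_eq_iff_eq_add] at h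
  simp [h]

theorem star_resolventOp_I (hT : IsSelfAdjoint T) :
    star (resolventOp T Complex.I) = resolventOp T (-Complex.I) := by
  rw [ContinuousLinearMap.star_eq_adjoint, adjoint_resolventOp hT (by simp), Complex.conj_I]

theorem resolventOp_I_sub_star (hT : IsSelfAdjoint T) :
    resolventOp T Complex.I - star (resolventOp T Complex.I) =
      (2 * Complex.I) • (resolventOp T Complex.I * star (resolventOp T Complex.I)) := by
  rw [star_resolventOp_I hT, resolventOp_sub hT (by simp) (by simp)]
  congr 1
  ring

theorem isStarNormal_resolventOp_I (hT : IsSelfAdjoint T) :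
    IsStarNormal (resolventOp T Complex.I) := by
  constructor
  have h1 := resolventOp_I_sub_star hT
  have h2 := resolventOp_sub hT (z := -Complex.I) (w := Complex.I) (by simp) (by simp)
  rw [← star_resolventOp_I hT] at h2
  have h3 : (2 * Complex.I) • (star (resolventOp T Complex.I) * resolventOp T Complex.I) =
      (2 * Complex.I) • (resolventOp T Complex.I * star (resolventOp T Complex.I)) := by
    rw [← h1, ← neg_sub, h2, ← neg_smul]
    congr 1
    ring
  exact smul_right_injective _ (by simp) h3

/-- The spectrum of `(T - i)⁻¹` lies on the circle that consists of `0` and the points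
`(x - i)⁻¹` for real `x`. -/
theorem im_eq_normSq_of_mem_spectrum (hT : IsSelfAdjoint T) {z : ℂ}
    (hz : z ∈ spectrum ℂ (resolventOp T Complex.I)) : z.im = Complex.normSq z := by
  have hn := isStarNormal_resolventOp_I hT
  -- The resolvent identity R - R* = 2i R R* passes to the points of the spectrum, because functions
  -- with the same `cfc` agree there.
  have h : cfc (fun z : ℂ => z - star z) (resolventOp T Complex.I) =
      cfc (fun z : ℂ => (2 * Complex.I) • (z * star z)) (resolventOp T Complex.I) := by
    rw [cfc_sub (fun z : ℂ => z) (fun z : ℂ => star z), cfc_smul (2 * Complex.I)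
      (fun z : ℂ => z * star z) (resolventOp T Complex.I), cfc_mul (fun z : ℂ => z) (fun z : ℂ => star z),
      cfc_star (fun z : ℂ => z), cfc_id' ℂ _,
      resolventOp_I_sub_star hT]
  have h2 := eqOn_of_cfc_eq_cfc h (by fun_prop) (by fun_prop) hn hz
  have h3 : z - star z = (2 * Complex.I) * (z * star z) := h2
  have h4 := congrArg Complex.im h3
  rw [Complex.star_def, Complex.mul_conj] at h4
  simp at h4
  linarith

end Resolvent

/-! ### The functional calculus on compactly supported continuous functions. -/

section FunCalc

open Filter Topology

theorem resolventSymbol_add (f g : ℝ → ℂ) :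
    resolventSymbol (f + g) = fun z => resolventSymbol f z + resolventSymbol g z := by
  funext z
  simp only [resolventSymbol]
  split_ifs <;> simp

theorem resolventSymbol_mul (f g : ℝ → ℂ) :
    resolventSymbol (f * g) = fun z => resolventSymbol f z * resolventSymbol g z := by
  funext z
  simp only [resolventSymbol]
  split_ifs <;> simp

theorem resolventSymbol_smul (c : ℂ) (f : ℝ → ℂ) :
    resolventSymbol (c • f) = fun z => c • resolventSymbol f z := by
  funext z
  simp only [resolventSymbol]
  split_ifs <;> simp

theorem resolventSymbol_star (f : ℝ → ℂ) :
    resolventSymbol (star f) = fun z => star (resolventSymbol f z) := by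
  funext z
  simp only [resolventSymbol]
  split_ifs <;> simp

theorem inv_eq_of_im_eq_normSq {z : ℂ} (hz : z.im = Complex.normSq z) (h0 : z ≠ 0) :
    z⁻¹ = ((z⁻¹).re : ℂ) - Complex.I := by
  apply Complex.ext
  · simp
  · have : Complex.normSq z ≠ 0 := (Complex.normSq_pos.2 h0).ne'
    simp only [Complex.inv_im, Complex.sub_im, Complex.ofReal_im, Complex.I_im, hz]
    field_simp
    simp

theorem abs_inv_re_mul_norm_le {z : ℂ} : |(z⁻¹).re| * ‖z‖ ≤ 1 := by
  calc |(z⁻¹).re| * ‖z‖ ≤ ‖z⁻¹‖ * ‖z‖ := by gcongr; exact Complex.abs_re_le_norm _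
    _ ≤ 1 := by rw [norm_inv]; exact inv_mul_le_one

/-- Only the point 0 is delicate. On the circle z⁻¹ = x - i, so z near 0 forces |x| to be large and
f x = 0; off the circle the real part of z⁻¹ may stay bounded. -/
theorem continuousOn_resolventSymbol {f : ℝ → ℂ} (hf : Continuous f) (hc : HasCompactSupport f) :
    ContinuousOn (resolventSymbol f) {z | z.im = Complex.normSq z} := by
  intro z hz
  by_cases h0 : z = 0
  · subst h0
    obtain ⟨r, hr⟩ := hc.isCompact.isBounded.subset_closedBall 0
    have hev : ∀ᶠ w in 𝓝[{z | z.im = Complex.normSq z}] (0 : ℂ), resolventSymbol f w = 0 := by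
      have h1 : ∀ᶠ w : ℂ in 𝓝 0, ‖w‖ * (|r| + 1) < 1 := by
        have : Continuous fun w : ℂ => ‖w‖ * (|r| + 1) := by fun_prop
        exact this.continuousAt.eventually_lt continuousAt_const (by simp)
      filter_upwards [self_mem_nhdsWithin, nhdsWithin_le_nhds h1] with w hw hw1
      by_cases hw0 : w = 0
      · simp [resolventSymbol, hw0]
      · rw [resolventSymbol, if_neg hw0]
        refine image_eq_zero_of_notMem_tsupport fun hmem => ?_
        have h2 := hr hmem
        rw [mem_closedBall_zero_iff, Real.norm_eq_abs] at h2
        have h3 : ‖w⁻¹‖ ≤ |r| + 1 := by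
          rw [inv_eq_of_im_eq_normSq hw hw0]
          refine (norm_sub_le _ _).trans ?_
          rw [Complex.norm_real, Complex.norm_I, Real.norm_eq_abs]
          linarith [le_abs_self r]
        have h4 : ‖w‖ * ‖w⁻¹‖ = 1 := by
          rw [← norm_mul, mul_inv_cancel₀ hw0, norm_one]
        have h5 := mul_le_mul_of_nonneg_left h3 (norm_nonneg w)
        linarith
    refine (tendsto_congr' hev).2 ?_
    simpa [resolventSymbol] using tendsto_const_nhds
  · refine ContinuousAt.continuousWithinAt ?_
    have h1 : ContinuousAt (fun w : ℂ => f (w⁻¹).re) z :=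
      (hf.comp Complex.continuous_re).continuousAt.comp (continuousAt_inv₀ h0)
    refine h1.congr ?_
    filter_upwards [isOpen_ne.mem_nhds h0] with w hw
    rw [resolventSymbol, if_neg hw]

/-- A continuous function with compact support that is `1` on `[-n, n]`. -/
noncomputable def cutoff (n : ℕ) (x : ℝ) : ℝ := max 0 (min 1 (n + 1 - |x|))

theorem continuous_cutoff (n : ℕ) : Continuous (cutoff n) := by
  unfold cutoff
  fun_prop

theorem cutoff_nonneg (n : ℕ) (x : ℝ) : 0 ≤ cutoff n x := le_max_left _ _

theorem cutoff_le_one (n : ℕ) (x : ℝ) : cutoff n x ≤ 1 :=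
  max_le zero_le_one (min_le_left _ _)

theorem cutoff_eq_one {n : ℕ} {x : ℝ} (h : |x| ≤ n) : cutoff n x = 1 := by
  rw [cutoff, min_eq_left (by linarith), max_eq_right zero_le_one]

theorem cutoff_eq_zero {n : ℕ} {x : ℝ} (h : n + 1 ≤ |x|) : cutoff n x = 0 :=
  max_eq_left ((min_le_right _ _).trans (by linarith))

theorem hasCompactSupport_cutoff (n : ℕ) : HasCompactSupport (cutoff n) := by
  refine HasCompactSupport.intro (isCompact_closedBall (0 : ℝ) (n + 1)) fun x hx => ?_
  rw [mem_closedBall_zero_iff, Real.norm_eq_abs, not_le] at hx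
  exact cutoff_eq_zero hx.le

theorem continuous_cutoff_complex (n : ℕ) : Continuous fun x => (cutoff n x : ℂ) :=
  Complex.continuous_ofReal.comp (continuous_cutoff n)

theorem hasCompactSupport_cutoff_complex (n : ℕ) : HasCompactSupport fun x => (cutoff n x : ℂ) :=
  (hasCompactSupport_cutoff n).comp_left (g := Complex.ofReal) Complex.ofReal_zero

variable {H : Type*} [NormedAddCommGroup H] [InnerProductSpace ℂ H] [CompleteSpace H]
  {T : H →ₗ.[ℂ] H}

theorem continuousOn_resolventSymbol_spectrum (hT : IsSelfAdjoint T) {f : ℝ → ℂ}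
    (hf : Continuous f) (hc : HasCompactSupport f) :
    ContinuousOn (resolventSymbol f) (spectrum ℂ (resolventOp T Complex.I)) :=
  (continuousOn_resolventSymbol hf hc).mono fun _ hz => im_eq_normSq_of_mem_spectrum hT hz

theorem funCalc_add (hT : IsSelfAdjoint T) {f g : ℝ → ℂ} (hf : Continuous f)
    (hcf : HasCompactSupport f) (hg : Continuous g) (hcg : HasCompactSupport g) :
    funCalc T (f + g) = funCalc T f + funCalc T g := by
  rw [funCalc, resolventSymbol_add, cfc_add _ _ _ (continuousOn_resolventSymbol_spectrum hT hf hcf)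
    (continuousOn_resolventSymbol_spectrum hT hg hcg)]
  rfl

theorem funCalc_mul (hT : IsSelfAdjoint T) {f g : ℝ → ℂ} (hf : Continuous f)
    (hcf : HasCompactSupport f) (hg : Continuous g) (hcg : HasCompactSupport g) :
    funCalc T (f * g) = funCalc T f * funCalc T g := by
  rw [funCalc, resolventSymbol_mul, cfc_mul _ _ _ (continuousOn_resolventSymbol_spectrum hT hf hcf)
    (continuousOn_resolventSymbol_spectrum hT hg hcg)]
  rfl

theorem funCalc_smul (hT : IsSelfAdjoint T) (c : ℂ) {f : ℝ → ℂ} (hf : Continuous f)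
    (hcf : HasCompactSupport f) : funCalc T (c • f) = c • funCalc T f := by
  rw [funCalc, resolventSymbol_smul, cfc_smul c (resolventSymbol f) _
    (continuousOn_resolventSymbol_spectrum hT hf hcf)]
  rfl

theorem funCalc_star (T : H →ₗ.[ℂ] H) (f : ℝ → ℂ) : funCalc T (star f) = star (funCalc T f) := by
  rw [funCalc, resolventSymbol_star, cfc_star]
  rfl

theorem norm_funCalc_le (T : H →ₗ.[ℂ] H) {f : ℝ → ℂ} {c : ℝ} (hc : 0 ≤ c)
    (h : ∀ x, ‖f x‖ ≤ c) : ‖funCalc T f‖ ≤ c := by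
  refine norm_cfc_le hc fun z _ => ?_
  rw [resolventSymbol]
  split_ifs
  · simpa using hc
  · exact h _

theorem ofReal_sub_I_ne_zero (x : ℝ) : (x : ℂ) - Complex.I ≠ 0 := fun h => by
  simpa using congrArg Complex.im h

/-- On the spectrum, a nonzero z equals (x - i)⁻¹ with x real. The product with f stays continuous
and compactly supported, which makes orbits invariant. -/
theorem resolventOp_mul_funCalc (hT : IsSelfAdjoint T) {f : ℝ → ℂ} (hf : Continuous f)
    (hc : HasCompactSupport f) : resolventOp T Complex.I * funCalc T f =
      funCalc T (fun x => ((x : ℂ) - Complex.I)⁻¹ * f x) := by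
  have hn := isStarNormal_resolventOp_I hT
  have h := cfc_mul (fun z : ℂ => z) (resolventSymbol f) (resolventOp T Complex.I)
    (by fun_prop) (continuousOn_resolventSymbol_spectrum hT hf hc)
  rw [cfc_id' ℂ _] at h
  rw [funCalc, ← h, funCalc]
  refine cfc_congr fun z hz => ?_
  simp only [resolventSymbol]
  split_ifs with h0
  · rw [mul_zero]
  · rw [← inv_eq_of_im_eq_normSq (im_eq_normSq_of_mem_spectrum hT hz) h0, inv_inv]

theorem commute_resolventOp_funCalc (hT : IsSelfAdjoint T) (f : ℝ → ℂ) :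
    Commute (resolventOp T Complex.I) (funCalc T f) := by
  have hn := isStarNormal_resolventOp_I hT
  exact ((Commute.refl _).cfc hn.star_comm_self _).symm

/-- The symbol of the difference is (1 - cutoff) · z: it vanishes for |x| ≤ n, and elsewhere |z| ≤ 1
/ |x| < 1 / n. -/
theorem norm_resolventOp_sub_le (hT : IsSelfAdjoint T) {n : ℕ} (hn0 : 0 < n) :
    ‖resolventOp T Complex.I - funCalc T (fun x => (cutoff n x : ℂ)) * resolventOp T Complex.I‖ ≤
      1 / n := by
  have hn := isStarNormal_resolventOp_I hT
  have hs := continuousOn_resolventSymbol_spectrum hT (continuous_cutoff_complex n)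
    (hasCompactSupport_cutoff_complex n)
  have h := cfc_sub (fun z : ℂ => z) (fun z => resolventSymbol (fun x => (cutoff n x : ℂ)) z * z)
    (resolventOp T Complex.I) (by fun_prop) (hs.mul continuousOn_id)
  rw [cfc_mul (resolventSymbol _) (fun z : ℂ => z) _ hs (by fun_prop), cfc_id' ℂ _] at h
  rw [funCalc, ← h]
  refine norm_cfc_le (by positivity) fun z hz => ?_
  simp only [resolventSymbol]
  split_ifs with h0
  · simp [h0]
  · by_cases hx : |(z⁻¹).re| ≤ n
    · rw [cutoff_eq_one hx]
      simp
    · rw [not_le] at hx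
      have hz1 : ‖z‖ ≤ 1 / n := by
        rw [le_div_iff₀ (by positivity), mul_comm]
        exact (mul_le_mul_of_nonneg_right hx.le (norm_nonneg z)).trans abs_inv_re_mul_norm_le
      have h1 : z - (cutoff n (z⁻¹).re : ℂ) * z = ((1 - cutoff n (z⁻¹).re : ℝ) : ℂ) * z := by
        push_cast; ring
      rw [h1, norm_mul, Complex.norm_real, Real.norm_eq_abs,
        abs_of_nonneg (sub_nonneg.2 (cutoff_le_one _ _))]
      refine (mul_le_of_le_one_left (norm_nonneg z) ?_).trans hz1
      linarith [cutoff_nonneg n (z⁻¹).re]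

theorem norm_funCalc_cutoff_le (T : H →ₗ.[ℂ] H) (n : ℕ) :
    ‖funCalc T (fun x => (cutoff n x : ℂ))‖ ≤ 1 := by
  refine norm_funCalc_le T zero_le_one fun x => ?_
  rw [Complex.norm_real, Real.norm_eq_abs, abs_of_nonneg (cutoff_nonneg n x)]
  exact cutoff_le_one n x

theorem denseRange_resolventOp (hT : IsSelfAdjoint T) {z : ℂ} (hz : z.im ≠ 0) :
    DenseRange (resolventOp T z) := by
  refine hT.dense_domain.mono fun x hx => ?_
  exact ⟨T ⟨x, hx⟩ - z • x, (isResolventAt_resolventOp hT hz _ _).2 ⟨hx, rfl⟩⟩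

/-- The cutoffs are contractions and converge on the range of the resolvent, which is dense. This is
what puts S into its own orbit and keeps spectral mass from escaping to infinity. -/
theorem tendsto_funCalc_cutoff (hT : IsSelfAdjoint T) (v : H) :
    Tendsto (fun n => funCalc T (fun x => (cutoff n x : ℂ)) v) atTop (𝓝 v) := by
  rw [Metric.tendsto_atTop]
  intro ε hε
  obtain ⟨y, hy⟩ := (denseRange_resolventOp hT (z := Complex.I) (by simp)).exists_dist_lt
    v (show 0 < ε / 3 by positivity)
  obtain ⟨N, hN⟩ := exists_nat_gt (3 * ‖y‖ / ε)
  refine ⟨N + 1, fun n hn => ?_⟩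
  have hn0 : 0 < n := by omega
  have hn1 : (N : ℝ) ≤ n := by exact_mod_cast (by omega : N ≤ n)
  set Φ := funCalc T (fun x => (cutoff n x : ℂ))
  set u := resolventOp T Complex.I y
  have h1 : ‖u - Φ u‖ ≤ 1 / n * ‖y‖ :=
    ((resolventOp T Complex.I - Φ * resolventOp T Complex.I).le_opNorm y).trans
      (mul_le_mul_of_nonneg_right (norm_resolventOp_sub_le hT hn0) (norm_nonneg y))
  have h2 : 1 / n * ‖y‖ < ε / 3 := by
    rw [div_lt_iff₀ hε] at hN
    have : (0 : ℝ) < n := by exact_mod_cast hn0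
    rw [one_div, inv_mul_lt_iff₀ this]
    nlinarith
  have h3 : ‖Φ (v - u)‖ ≤ ‖v - u‖ := by
    simpa using (Φ.le_opNorm (v - u)).trans
      (mul_le_mul_of_nonneg_right (norm_funCalc_cutoff_le T n) (norm_nonneg _))
  rw [dist_eq_norm] at hy ⊢
  have h4 : Φ v - v = Φ (v - u) + (-(u - Φ u) + -(v - u)) := by
    rw [map_sub]; abel
  rw [h4]
  refine (norm_add_le _ _).trans_lt ?_
  have h5 := norm_add_le (-(u - Φ u)) (-(v - u))
  rw [norm_neg, norm_neg] at h5
  linarith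

end FunCalc

/-! ### Orbits as smallest closed reducing subspaces. -/

section Orbit

variable {H : Type*} [NormedAddCommGroup H] [InnerProductSpace ℂ H]

/-- Invariance of K under the adjoint makes Kᗮ invariant under A, so A is block diagonal. -/
theorem commute_starProjection_of_invariant [CompleteSpace H] {A : H →L[ℂ] H} {K : Submodule ℂ H}
    [K.HasOrthogonalProjection] (h1 : ∀ x ∈ K, A x ∈ K) (h2 : ∀ x ∈ K, (star A) x ∈ K) :
    Commute A K.starProjection := by
  ext x
  refine (Submodule.eq_starProjection_of_mem_orthogonal (h1 _ (K.starProjection_apply_mem x))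
    ?_).symm
  change A x - A (K.starProjection x) ∈ Kᗮ
  rw [← map_sub, Submodule.mem_orthogonal']
  intro u hu
  rw [← ContinuousLinearMap.adjoint_inner_right]
  exact Submodule.inner_left_of_mem_orthogonal (h2 u hu) (K.sub_starProjection_mem_orthogonal x)

theorem apply_mem_of_commute_starProjection {A : H →L[ℂ] H} {K : Submodule ℂ H}
    [K.HasOrthogonalProjection] (h : Commute A K.starProjection) {x : H} (hx : x ∈ K) :
    A x ∈ K := by
  have h1 : A (K.starProjection x) = K.starProjection (A x) := DFunLike.congr_fun h x
  rw [Submodule.starProjection_eq_self_iff.2 hx] at h1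
  exact Submodule.starProjection_eq_self_iff.1 h1.symm

theorem commute_star_starProjection [CompleteSpace H] {A : H →L[ℂ] H} {K : Submodule ℂ H}
    [K.HasOrthogonalProjection] (h : Commute A K.starProjection) :
    Commute (star A) K.starProjection := by
  have h1 := h.star_star
  rwa [(isSelfAdjoint_starProjection K).star_eq] at h1

variable [CompleteSpace H] {T : H →ₗ.[ℂ] H}

/-- A closed subspace reduces `T` if its orthogonal projection leaves the graph of `T`
invariant. -/
def Reduces (T : H →ₗ.[ℂ] H) (K : Submodule ℂ H) [K.HasOrthogonalProjection] : Prop :=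
  ∀ x y, (x, y) ∈ T.graph → (K.starProjection x, K.starProjection y) ∈ T.graph

theorem reduces_iff_commute (hT : IsSelfAdjoint T) {K : Submodule ℂ H}
    [K.HasOrthogonalProjection] :
    Reduces T K ↔ Commute (resolventOp T Complex.I) K.starProjection := by
  have hR := isResolventAt_iff_mem_graph.1
    (isResolventAt_resolventOp hT (z := Complex.I) (by simp))
  constructor
  · intro h
    ext y
    have h1 := h _ _ (resolventOp_mem_graph hT (z := Complex.I) (by simp) y)
    rw [map_add, map_smul, ← hR] at h1
    exact h1
  · intro h x y hxy
    have h1 : resolventOp T Complex.I (y - Complex.I • x) = x := by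
      rw [hR]
      simpa using hxy
    have h2 := DFunLike.congr_fun h.eq (y - Complex.I • x)
    simp only [mul_apply_eq_comp, h1, map_sub (K.starProjection),
      map_smul (K.starProjection)] at h2
    rw [hR] at h2
    simpa using h2

theorem Reduces.commute_funCalc (hT : IsSelfAdjoint T) {K : Submodule ℂ H}
    [K.HasOrthogonalProjection] (h : Reduces T K) (f : ℝ → ℂ) :
    Commute (funCalc T f) K.starProjection := by
  rw [reduces_iff_commute hT] at h
  exact h.cfc (commute_star_starProjection h) _

theorem isClosed_orbit (T : H →ₗ.[ℂ] H) (S : Set H) : IsClosed (orbit T S : Set H) :=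
  Submodule.isClosed_topologicalClosure _

instance (T : H →ₗ.[ℂ] H) (S : Set H) : (orbit T S).HasOrthogonalProjection :=
  have : CompleteSpace (orbit T S) := (isClosed_orbit T S).completeSpace_coe
  inferInstance

theorem funCalc_mem_orbit {S : Set H} {f : ℝ → ℂ} (hf : Continuous f) (hc : HasCompactSupport f)
    {w : H} (hw : w ∈ S) : funCalc T f w ∈ orbit T S :=
  Submodule.le_topologicalClosure _ (Submodule.subset_span ⟨f, hf, hc, w, hw, rfl⟩)

theorem subset_orbit (hT : IsSelfAdjoint T) (S : Set H) : S ⊆ orbit T S := fun w hw =>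
  (isClosed_orbit T S).mem_of_tendsto (tendsto_funCalc_cutoff hT w)
    (Filter.Eventually.of_forall fun n => funCalc_mem_orbit (continuous_cutoff_complex n)
      (hasCompactSupport_cutoff_complex n) hw)

theorem orbit_le (hT : IsSelfAdjoint T) {S : Set H} {K : Submodule ℂ H} (hK : IsClosed (K : Set H))
    [K.HasOrthogonalProjection] (h : Reduces T K) (hS : S ⊆ K) : orbit T S ≤ K := by
  refine Submodule.topologicalClosure_minimal _ (Submodule.span_le.2 ?_) hK
  rintro _ ⟨f, -, -, w, hw, rfl⟩
  exact apply_mem_of_commute_starProjection (h.commute_funCalc hT f) (hS hw)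

theorem apply_mem_orbit {S : Set H} {A : H →L[ℂ] H}
    (h : ∀ f : ℝ → ℂ, Continuous f → HasCompactSupport f → ∀ w ∈ S,
      A (funCalc T f w) ∈ orbit T S) {x : H} (hx : x ∈ orbit T S) : A x ∈ orbit T S := by
  have h1 : orbit T S ≤ (orbit T S).comap (A : H →ₗ[ℂ] H) := by
    refine Submodule.topologicalClosure_minimal _ (Submodule.span_le.2 ?_)
      ((isClosed_orbit T S).preimage A.continuous)
    rintro _ ⟨f, hf, hc, w, hw, rfl⟩
    exact h f hf hc w hw
  exact h1 hx

/-- The resolvent and its adjoint turn f(T)w into g(T)w with g again continuous of compact support.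
-/
theorem reduces_orbit (hT : IsSelfAdjoint T) (S : Set H) : Reduces T (orbit T S) := by
  rw [reduces_iff_commute hT]
  have hcont : Continuous fun x : ℝ => ((x : ℂ) - Complex.I)⁻¹ :=
    (Complex.continuous_ofReal.sub continuous_const).inv₀ ofReal_sub_I_ne_zero
  refine commute_starProjection_of_invariant (fun x => apply_mem_orbit ?_)
    (fun x => apply_mem_orbit ?_)
  · intro f hf hc w hw
    have h := DFunLike.congr_fun (resolventOp_mul_funCalc hT hf hc) w
    rw [mul_apply_eq_comp] at h
    rw [h]
    exact funCalc_mem_orbit (hcont.mul hf) hc.mul_left hw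
  · intro f hf hc w hw
    have hf' : Continuous (star f) := continuous_star.comp hf
    have hc' : HasCompactSupport (star f) := hc.comp_left (g := star) (star_zero ℂ)
    -- The formula for the adjoint resolvent comes from the one for the conjugate of f by taking
    -- adjoints.
    have h := congrArg star (resolventOp_mul_funCalc hT hf' hc')
    rw [star_mul, ← funCalc_star, ← funCalc_star, star_star] at h
    have h1 := (commute_resolventOp_funCalc hT (star f)).star_star
    rw [← funCalc_star, star_star] at h1
    have h2 := DFunLike.congr_fun (h1.eq.trans h) w
    rw [mul_apply_eq_comp] at h2
    rw [h2]
    exact funCalc_mem_orbit (continuous_star.comp (hcont.mul hf'))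
      ((hc'.mul_left (f := fun x : ℝ => ((x : ℂ) - Complex.I)⁻¹)).comp_left (g := star)
        (star_zero ℂ)) hw

end Orbit

/-! ### The block operator matrix and its coupled component. -/

section Block

variable {H : Type*} [NormedAddCommGroup H] [InnerProductSpace ℂ H]

theorem mem_graph_compression {T : H →ₗ.[ℂ] H} {K : Submodule ℂ H} [K.HasOrthogonalProjection]
    {a b : K} : (a, b) ∈ (compression T K).graph ↔
      ∃ y, ((a : H), y) ∈ T.graph ∧ K.orthogonalProjectionOnto y = b := by
  rw [LinearPMap.mem_graph_iff]
  constructor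
  · rintro ⟨⟨a', ha⟩, rfl, rfl⟩
    exact ⟨T ⟨a', ha⟩, T.mem_graph ⟨_, ha⟩, rfl⟩
  · rintro ⟨y, hy, rfl⟩
    have ha : (a : H) ∈ T.domain := LinearPMap.mem_domain_of_mem_graph hy
    rw [T.mem_graph_snd_inj hy (T.mem_graph ⟨a, ha⟩) rfl]
    exact ⟨⟨a, ha⟩, rfl, rfl⟩

theorem compression_mem_graph {T : H →ₗ.[ℂ] H} {K : Submodule ℂ H} [K.HasOrthogonalProjection]
    {a : K} {y : H} (h : ((a : H), y) ∈ T.graph) :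
    (a, K.orthogonalProjectionOnto y) ∈ (compression T K).graph :=
  mem_graph_compression.2 ⟨y, h, rfl⟩

theorem exists_mem_graph {T : H →ₗ.[ℂ] H} {x : H} (hx : x ∈ T.domain) : ∃ y, (x, y) ∈ T.graph :=
  ⟨_, T.mem_graph ⟨x, hx⟩⟩

/-- The projection onto K is continuous and surjective, so the image of D is dense in K; by
hypothesis that image lies in D. -/
theorem dense_of_starProjection_mem {K D : Submodule ℂ H} [K.HasOrthogonalProjection]
    (hD : Dense (D : Set H)) (h : ∀ x ∈ D, K.starProjection x ∈ D) :
    Dense (D.comap K.subtype : Set K) := by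
  have hs : Function.Surjective K.orthogonalProjectionOnto := fun a =>
    ⟨a, K.orthogonalProjectionOnto_mem_subspace_eq_self a⟩
  refine (hs.denseRange.dense_image K.orthogonalProjectionOnto.continuous hD).mono ?_
  rintro _ ⟨x, hx, rfl⟩
  exact h x hx

variable {T : H →ₗ.[ℂ] H} {H₁ : Submodule ℂ H} [H₁.HasOrthogonalProjection] {Γ : H₁ᗮ →L[ℂ] H₁}

theorem HasBoundedCoupling.apply_eq (h : HasBoundedCoupling T H₁ Γ) {x : H₁ᗮ} {y : H}
    (hx : ((x : H), y) ∈ T.graph) : Γ x = H₁.orthogonalProjectionOnto y := by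
  have hx' : (x : H) ∈ T.domain := LinearPMap.mem_domain_of_mem_graph hx
  rw [T.mem_graph_snd_inj hx (T.mem_graph ⟨x, hx'⟩) rfl]
  exact h.coupling_apply x hx'

theorem HasBoundedCoupling.starProjection_orthogonal_mem (h : HasBoundedCoupling T H₁ Γ) {x : H}
    (hx : x ∈ T.domain) : H₁ᗮ.starProjection x ∈ T.domain := by
  rw [Submodule.starProjection_orthogonal_val]
  exact T.domain.sub_mem hx (h.proj_mem_domain x hx)

theorem coe_add_coe_orthogonal (H₁ : Submodule ℂ H) [H₁.HasOrthogonalProjection] (x : H) :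
    (H₁.orthogonalProjectionOnto x : H) + (H₁ᗮ.orthogonalProjectionOnto x : H) = x :=
  H₁.starProjection_add_starProjection_orthogonal x

/-- The graph of a block operator matrix is spanned by the graphs of its two columns. -/
theorem HasBoundedCoupling.exists_decomposition (h : HasBoundedCoupling T H₁ Γ) {x y : H}
    (hx : (x, y) ∈ T.graph) : ∃ (x₁ : H₁) (x₂ : H₁ᗮ) (y₁ y₂ : H), ((x₁ : H), y₁) ∈ T.graph ∧
      ((x₂ : H), y₂) ∈ T.graph ∧ (x₁ : H) + x₂ = x ∧ y₁ + y₂ = y := by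
  have hxd : x ∈ T.domain := LinearPMap.mem_domain_of_mem_graph hx
  obtain ⟨y₁, hy₁⟩ := exists_mem_graph (h.proj_mem_domain x hxd)
  refine ⟨H₁.orthogonalProjectionOnto x, H₁ᗮ.orthogonalProjectionOnto x, y₁, y - y₁, hy₁, ?_,
    coe_add_coe_orthogonal H₁ x, by abel⟩
  have h1 := T.graph.sub_mem hx hy₁
  rw [Prod.mk_sub_mk] at h1
  convert h1
  exact Submodule.starProjection_orthogonal_val x

variable [CompleteSpace H]

theorem HasBoundedCoupling.dense_domain (hT : IsSelfAdjoint T) (h : HasBoundedCoupling T H₁ Γ) :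
    Dense ((compression T H₁ᗮ).domain : Set H₁ᗮ) :=
  dense_of_starProjection_mem hT.dense_domain fun _ hx => h.starProjection_orthogonal_mem hx

variable [CompleteSpace H₁]

/-- Symmetry of T identifies the lower off-diagonal entry when tested on the part of the domain in
H₁ᗮ, which is dense there. -/
theorem HasBoundedCoupling.orthogonal_part_eq (hT : IsSelfAdjoint T)
    (h : HasBoundedCoupling T H₁ Γ)
    {x : H₁} {y : H}
    (hx : ((x : H), y) ∈ T.graph) :
    H₁ᗮ.orthogonalProjectionOnto y = ContinuousLinearMap.adjoint Γ x := by
  refine (h.dense_domain hT).eq_of_inner_left ℂ fun u hu => ?_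
  obtain ⟨v, hv⟩ := exists_mem_graph (show (u : H) ∈ T.domain from hu)
  rw [Submodule.inner_orthogonalProjectionOnto_eq_of_mem_right,
    ContinuousLinearMap.adjoint_inner_left, h.apply_eq hv,
    Submodule.inner_orthogonalProjectionOnto_eq_of_mem_left]
  exact inner_eq_of_mem_graph hT hx hv

/-- If y lies in the domain of the adjoint of the compression with value w, then w + Γy serves as an
adjoint value of T at y, because Γ is defined everywhere. Self-adjointness of T then puts y into the
domain. -/
theorem HasBoundedCoupling.isSelfAdjoint_compression (hT : IsSelfAdjoint T)
    (h : HasBoundedCoupling T H₁ Γ) : IsSelfAdjoint (compression T H₁ᗮ) := by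
  refine isSelfAdjoint_of_symmetric_of_maximal (h.dense_domain hT) ?_ ?_
  · rintro ⟨x, hx⟩ ⟨y, hy⟩
    change ⟪H₁ᗮ.orthogonalProjectionOnto (T ⟨x, hx⟩), y⟫_ℂ =
      ⟪x, H₁ᗮ.orthogonalProjectionOnto (T ⟨y, hy⟩)⟫_ℂ
    rw [Submodule.inner_orthogonalProjectionOnto_eq_of_mem_right,
      Submodule.inner_orthogonalProjectionOnto_eq_of_mem_left]
    exact inner_apply_eq_of_isSelfAdjoint hT ⟨x, hx⟩ ⟨y, hy⟩
  · intro y w hw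
    have h1 : ((y : H), (w : H) + Γ y) ∈ T.graph := by
      refine mem_graph_of_isSelfAdjoint hT fun x => ?_
      obtain ⟨x₁, x₂, y₁, y₂, h₁, h₂, hx, hy⟩ := h.exists_decomposition (T.mem_graph x)
      have e1 : ⟪w, x₂⟫_ℂ = ⟪(y : H), y₂⟫_ℂ := by
        have hg := compression_mem_graph (K := H₁ᗮ) h₂
        rw [LinearPMap.mem_graph_iff] at hg
        obtain ⟨a, ha, hb⟩ := hg
        have := hw a
        rwa [ha, hb, Submodule.inner_orthogonalProjectionOnto_eq_of_mem_left] at this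
      have e2 : ⟪Γ y, x₁⟫_ℂ = ⟪(y : H), y₁⟫_ℂ := by
        rw [← ContinuousLinearMap.adjoint_inner_right, ← h.orthogonal_part_eq hT h₁,
          Submodule.inner_orthogonalProjectionOnto_eq_of_mem_left]
      have e3 : ⟪(w : H), (x₁ : H)⟫_ℂ = 0 :=
        Submodule.inner_left_of_mem_orthogonal x₁.2 w.2
      have e4 : ⟪(Γ y : H), (x₂ : H)⟫_ℂ = 0 :=
        Submodule.inner_right_of_mem_orthogonal (Γ y).2 x₂.2
      rw [Submodule.coe_inner] at e1 e2
      rw [← hx, ← hy, inner_add_left, inner_add_right, inner_add_right, inner_add_right, e1, e2,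
        e3, e4]
      ring
    exact (LinearPMap.mem_domain_of_mem_graph h1 : (y : H) ∈ T.domain)

omit [CompleteSpace H₁] in
theorem HasBoundedCoupling.dense_domain_left (hT : IsSelfAdjoint T)
    (h : HasBoundedCoupling T H₁ Γ) : Dense (T.domain.comap H₁.subtype : Set H₁) :=
  dense_of_starProjection_mem hT.dense_domain h.proj_mem_domain

omit [CompleteSpace H] [CompleteSpace H₁] in
-- The hypothesis says K = H₁ ⊕ K₂, so the projection is block diagonal with the identity on H₁.
theorem starProjection_eq_add_of_mem_iff {K : Submodule ℂ H} {K₂ : Submodule ℂ H₁ᗮ}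
    [K.HasOrthogonalProjection] [K₂.HasOrthogonalProjection]
    (hK : ∀ x, x ∈ K ↔ H₁ᗮ.orthogonalProjectionOnto x ∈ K₂) (x : H) :
    K.starProjection x =
      H₁.orthogonalProjectionOnto x + K₂.starProjection (H₁ᗮ.orthogonalProjectionOnto x) := by
  refine Submodule.eq_starProjection_of_mem_orthogonal (K := K) ?_ ?_
  · rw [hK, map_add, Submodule.orthogonalProjectionOnto_mem_subspace_eq_self,
      Submodule.orthogonalProjectionOnto_orthogonal_apply_eq_zero (SetLike.coe_mem _), zero_add]
    exact K₂.starProjection_apply_mem _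
  · rw [Submodule.mem_orthogonal]
    intro u hu
    have h1 := K₂.sub_starProjection_mem_orthogonal (H₁ᗮ.orthogonalProjectionOnto x)
    have h2 := Submodule.inner_right_of_mem_orthogonal ((hK u).1 hu) h1
    rw [Submodule.inner_orthogonalProjectionOnto_eq_of_mem_right] at h2
    rw [← h2]
    nth_rw 1 [← coe_add_coe_orthogonal H₁ x]
    rw [add_sub_add_left_eq_sub, Submodule.coe_sub]

/-- The hidden variables coupled to `H₁` are the closed orbit, under the action of the lower
diagonal entry, of the range of the lower off-diagonal entry. -/
theorem HasBoundedCoupling.coupledComponent_le (hT : IsSelfAdjoint T)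
    (h : HasBoundedCoupling T H₁ Γ) :
    coupledComponent T H₁ ≤
      orbit (compression T H₁ᗮ) ((ContinuousLinearMap.adjoint Γ).range : Set H₁ᗮ) := by
  have hT₂ := h.isSelfAdjoint_compression hT
  set K₂ := orbit (compression T H₁ᗮ) ((ContinuousLinearMap.adjoint Γ).range : Set H₁ᗮ) with hK₂
  have hsub : ∀ x : H₁, ContinuousLinearMap.adjoint Γ x ∈ K₂ := fun x =>
    subset_orbit hT₂ _ ⟨x, rfl⟩
  -- K₂ contains Ran Γ†, whose orthogonal complement is the kernel of Γ.
  have hker : ∀ x ∈ K₂ᗮ, Γ x = 0 := fun x hx => by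
    rw [← inner_self_eq_zero (𝕜 := ℂ), ← ContinuousLinearMap.adjoint_inner_left]
    exact Submodule.inner_right_of_mem_orthogonal (hsub _) hx
  -- This is H₁ ⊕ K₂. It reduces T column by column: the first column maps into H₁ ⊕ Ran Γ† ⊆ K, and
  -- in the second Γ does not see the part of x₂ outside K₂.
  set K := K₂.comap (H₁ᗮ.orthogonalProjectionOnto : H →ₗ[ℂ] H₁ᗮ)
  have hK : IsClosed (K : Set H) :=
    (isClosed_orbit _ _).preimage H₁ᗮ.orthogonalProjectionOnto.continuous
  have : CompleteSpace K := hK.completeSpace_coe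
  have hred : Reduces T K := by
    intro x y hxy
    obtain ⟨x₁, x₂, y₁, y₂, h₁, h₂, rfl, rfl⟩ := h.exists_decomposition hxy
    rw [map_add, map_add, ← Prod.mk_add_mk]
    refine T.graph.add_mem ?_ ?_
    · rw [Submodule.starProjection_eq_self_iff.2, Submodule.starProjection_eq_self_iff.2]
      · exact h₁
      · change H₁ᗮ.orthogonalProjectionOnto y₁ ∈ K₂
        rw [h.orthogonal_part_eq hT h₁]
        exact hsub x₁
      · change H₁ᗮ.orthogonalProjectionOnto (x₁ : H) ∈ K₂
        rw [Submodule.orthogonalProjectionOnto_orthogonal_apply_eq_zero x₁.2]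
        exact K₂.zero_mem
    · obtain ⟨y, hy, hy'⟩ := mem_graph_compression.1
        (reduces_orbit hT₂ _ _ _ (compression_mem_graph (K := H₁ᗮ) h₂))
      have e1 : Γ x₂ = Γ (K₂.starProjection x₂) := by
        rw [← sub_eq_zero, ← map_sub]
        exact hker _ (K₂.sub_starProjection_mem_orthogonal x₂)
      rw [starProjection_eq_add_of_mem_iff (K₂ := K₂) (fun _ => Iff.rfl),
        starProjection_eq_add_of_mem_iff (K₂ := K₂) (fun _ => Iff.rfl), ← h.apply_eq h₂, e1,
        h.apply_eq hy, ← hy', coe_add_coe_orthogonal,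
        Submodule.orthogonalProjectionOnto_mem_subspace_eq_self,
        Submodule.orthogonalProjectionOnto_apply_of_mem_orthogonal x₂.2]
      simpa using hy
  have hle : minimalExtension T H₁ ≤ K := by
    refine orbit_le hT hK hred fun x hx => ?_
    change H₁ᗮ.orthogonalProjectionOnto x ∈ K₂
    rw [Submodule.orthogonalProjectionOnto_orthogonal_apply_eq_zero hx]
    exact K₂.zero_mem
  intro x hx
  have := hle hx
  change H₁ᗮ.orthogonalProjectionOnto (x : H) ∈ K₂ at this
  rwa [Submodule.orthogonalProjectionOnto_mem_subspace_eq_self] at this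

omit [H₁.HasOrthogonalProjection] [CompleteSpace H₁] in
theorem isClosed_coupledComponent : IsClosed (coupledComponent T H₁ : Set H₁ᗮ) :=
  (isClosed_orbit T (H₁ : Set H)).preimage continuous_subtype_val

instance : (coupledComponent T H₁).HasOrthogonalProjection :=
  have hc : IsClosed (coupledComponent T H₁ : Set H₁ᗮ) :=
    (isClosed_orbit T (H₁ : Set H)).preimage continuous_subtype_val
  have : CompleteSpace (coupledComponent T H₁) := hc.completeSpace_coe
  inferInstance

omit [H₁.HasOrthogonalProjection] [CompleteSpace H] [CompleteSpace H₁] in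
-- As K contains H₁, its projection preserves H₁ᗮ and restricts there to the projection onto K ∩
-- H₁ᗮ.
theorem coe_starProjection_of_mem_iff {K : Submodule ℂ H} {K₂ : Submodule ℂ H₁ᗮ}
    [K.HasOrthogonalProjection] [K₂.HasOrthogonalProjection] (hK : H₁ ≤ K)
    (h : ∀ x : H₁ᗮ, x ∈ K₂ ↔ (x : H) ∈ K) (x : H₁ᗮ) :
    (K₂.starProjection x : H) = K.starProjection x := by
  have hm : K.starProjection x ∈ H₁ᗮ := by
    rw [Submodule.mem_orthogonal]
    intro u hu
    rw [← Submodule.inner_starProjection_left_eq_right,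
      Submodule.starProjection_eq_self_iff.2 (hK hu)]
    exact Submodule.inner_right_of_mem_orthogonal hu x.2
  have : K₂.starProjection x = ⟨K.starProjection x, hm⟩ := by
    refine Submodule.eq_starProjection_of_mem_orthogonal (K := K₂) ?_ ?_
    · exact (h _).2 (K.starProjection_apply_mem x)
    · rw [Submodule.mem_orthogonal]
      intro u hu
      exact Submodule.inner_right_of_mem_orthogonal (K := K) ((h u).1 hu)
        (K.sub_starProjection_mem_orthogonal (x : H))
  rw [this]

/-- The minimal extension reduces T and contains H₁, so its trace on H₁ᗮ reduces the compression. It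
remains to see that this trace contains Ran Γ†. -/
theorem HasBoundedCoupling.orbit_le_coupledComponent (hT : IsSelfAdjoint T)
    (h : HasBoundedCoupling T H₁ Γ) :
    orbit (compression T H₁ᗮ) ((ContinuousLinearMap.adjoint Γ).range : Set H₁ᗮ) ≤
      coupledComponent T H₁ := by
  have hT₂ := h.isSelfAdjoint_compression hT
  have hle : H₁ ≤ orbit T (H₁ : Set H) := subset_orbit hT _
  have hproj : ∀ x : H₁ᗮ, ((coupledComponent T H₁).starProjection x : H) =
      (orbit T (H₁ : Set H)).starProjection x :=
    coe_starProjection_of_mem_iff hle fun _ => Iff.rfl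
  have hred := reduces_orbit hT (H₁ : Set H)
  refine orbit_le hT₂ isClosed_coupledComponent ?_ ?_
  · intro x y hxy
    obtain ⟨z, hz, rfl⟩ := mem_graph_compression.1 hxy
    refine mem_graph_compression.2 ⟨_, hproj x ▸ hred _ _ hz, ?_⟩
    rw [← coe_add_coe_orthogonal H₁ z, map_add, Submodule.starProjection_eq_self_iff.2
      (hle (SetLike.coe_mem _)), ← hproj, map_add,
      Submodule.orthogonalProjectionOnto_orthogonal_apply_eq_zero (SetLike.coe_mem _), zero_add,
      Submodule.orthogonalProjectionOnto_mem_subspace_eq_self, map_add,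
      Submodule.orthogonalProjectionOnto_orthogonal_apply_eq_zero (SetLike.coe_mem _), zero_add,
      Submodule.orthogonalProjectionOnto_mem_subspace_eq_self]
  -- For u ∈ H₁ in the domain, Tu stays in the minimal extension, and so does Γ†u = Tu - P₁Tu. Such
  -- u are only dense in H₁, hence the closedness.
  · have hcl : IsClosed {x : H₁ | ContinuousLinearMap.adjoint Γ x ∈ coupledComponent T H₁} :=
      isClosed_coupledComponent.preimage (ContinuousLinearMap.adjoint Γ).continuous
    have hsub : ∀ x : H₁, ContinuousLinearMap.adjoint Γ x ∈ coupledComponent T H₁ := by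
      intro x
      refine hcl.closure_subset_iff.2 (fun u hu => ?_) ((h.dense_domain_left hT).closure_eq ▸
        Set.mem_univ x)
      obtain ⟨y, hy⟩ := exists_mem_graph (show (u : H) ∈ T.domain from hu)
      have h1 := hred _ _ hy
      rw [Submodule.starProjection_eq_self_iff.2 (hle u.2)] at h1
      have h2 := Submodule.starProjection_eq_self_iff.1 (T.mem_graph_snd_inj h1 hy rfl)
      change ((ContinuousLinearMap.adjoint Γ u : H₁ᗮ) : H) ∈ orbit T (H₁ : Set H)
      rw [← h.orthogonal_part_eq hT hy, ← add_sub_cancel_left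
        (H₁.orthogonalProjectionOnto y : H) (H₁ᗮ.orthogonalProjectionOnto y : H),
        coe_add_coe_orthogonal]
      exact Submodule.sub_mem _ h2 (hle (SetLike.coe_mem _))
    rintro _ ⟨x, rfl⟩
    exact hsub x

theorem HasBoundedCoupling.coupledComponent_eq (hT : IsSelfAdjoint T)
    (h : HasBoundedCoupling T H₁ Γ) :
    coupledComponent T H₁ =
      orbit (compression T H₁ᗮ) ((ContinuousLinearMap.adjoint Γ).range : Set H₁ᗮ) :=
  le_antisymm (h.coupledComponent_le hT) (h.orbit_le_coupledComponent hT)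

end Block

/-! ### Scalar spectral measures by the Riesz-Markov theorem. -/

section SpectralMeasure

open Filter Topology MeasureTheory
open scoped ENNReal CompactlySupported

variable {H : Type*} [NormedAddCommGroup H] [InnerProductSpace ℂ H] [CompleteSpace H]
  {T : H →ₗ.[ℂ] H}

theorem inner_funCalc_star (T : H →ₗ.[ℂ] H) (f : ℝ → ℂ) (v w : H) :
    ⟪funCalc T f v, w⟫_ℂ = ⟪v, funCalc T (star f) w⟫_ℂ := by
  rw [funCalc_star, ContinuousLinearMap.star_eq_adjoint, ContinuousLinearMap.adjoint_inner_right]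

theorem star_ofReal_comp (f : ℝ → ℝ) : star (fun x => (f x : ℂ)) = fun x => (f x : ℂ) :=
  funext fun x => Complex.conj_ofReal (f x)

theorem inner_funCalc_ofReal_im (T : H →ₗ.[ℂ] H) (f : ℝ → ℝ) (v : H) :
    (⟪v, funCalc T (fun x => (f x : ℂ)) v⟫_ℂ).im = 0 := by
  rw [← Complex.conj_eq_iff_im, inner_conj_symm, inner_funCalc_star, star_ofReal_comp]

theorem inner_funCalc_ofReal (T : H →ₗ.[ℂ] H) (f : ℝ → ℝ) (v : H) :
    ⟪v, funCalc T (fun x => (f x : ℂ)) v⟫_ℂ =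
      ((⟪v, funCalc T (fun x => (f x : ℂ)) v⟫_ℂ).re : ℂ) :=
  Complex.ext rfl (by rw [inner_funCalc_ofReal_im, Complex.ofReal_im])

theorem hasCompactSupport_ofReal_comp {f : ℝ → ℝ} (hf : HasCompactSupport f) :
    HasCompactSupport fun x => (f x : ℂ) :=
  hf.comp_left (g := Complex.ofReal) Complex.ofReal_zero

theorem continuous_ofReal_comp {f : ℝ → ℝ} (hf : Continuous f) :
    Continuous fun x => (f x : ℂ) :=
  Complex.continuous_ofReal.comp hf

theorem continuous_star_comp {f : ℝ → ℂ} (hf : Continuous f) : Continuous (star f) :=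
  continuous_star.comp hf

/-- With g = √f, the form equals ‖g(T)v‖². -/
theorem re_inner_funCalc_nonneg (hT : IsSelfAdjoint T) {f : ℝ → ℝ} (hf : Continuous f)
    (hc : HasCompactSupport f) (h0 : 0 ≤ f) (v : H) :
    0 ≤ (⟪v, funCalc T (fun x => (f x : ℂ)) v⟫_ℂ).re := by
  set g : ℝ → ℂ := fun x => ((√(f x) : ℝ) : ℂ) with hg
  have hgc : Continuous g := continuous_ofReal_comp (Real.continuous_sqrt.comp hf)
  have hgs : HasCompactSupport g :=
    hasCompactSupport_ofReal_comp (hc.comp_left (g := Real.sqrt) Real.sqrt_zero)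
  have h : (fun x => (f x : ℂ)) = star g * g := by
    rw [hg, star_ofReal_comp]
    funext x
    rw [Pi.mul_apply, ← Complex.ofReal_mul, Real.mul_self_sqrt (h0 x)]
  have hgs' : HasCompactSupport (star g) := hgs.comp_left (g := star) (star_zero ℂ)
  rw [h, funCalc_mul hT (continuous_star_comp hgc) hgs' hgc hgs, mul_apply_eq_comp,
    ← inner_funCalc_star]
  exact inner_self_nonneg (𝕜 := ℂ)

/-- The positive functional `f ↦ ⟪v, f(T) v⟫` on the continuous functions with compact support. -/
noncomputable def spectralFunctional (hT : IsSelfAdjoint T) (v : H) : C_c(ℝ, ℝ) →ₚ[ℝ] ℝ :=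
  PositiveLinearMap.mk₀
    { toFun := fun f => (⟪v, funCalc T (fun x => (f x : ℂ)) v⟫_ℂ).re
      map_add' := fun f g => by
        have h : (fun x => ((f + g) x : ℂ)) = (fun x => (f x : ℂ)) + fun x => (g x : ℂ) := by
          funext x; simp
        rw [h, funCalc_add hT (continuous_ofReal_comp (map_continuous f))
          (hasCompactSupport_ofReal_comp f.hasCompactSupport)
          (continuous_ofReal_comp (map_continuous g))
          (hasCompactSupport_ofReal_comp g.hasCompactSupport)]
        simp
      map_smul' := fun c f => by
        have h : (fun x => ((c • f) x : ℂ)) = (c : ℂ) • fun x => (f x : ℂ) := by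
          funext x; simp
        rw [h, funCalc_smul hT _ (continuous_ofReal_comp (map_continuous f))
          (hasCompactSupport_ofReal_comp f.hasCompactSupport)]
        simp }
    fun f hf => re_inner_funCalc_nonneg hT f.continuous f.hasCompactSupport hf v

/-- The spectral measure of the vector `v` for the self-adjoint operator `T`. -/
noncomputable def spectralMeasure (hT : IsSelfAdjoint T) (v : H) : Measure ℝ :=
  RealRMK.rieszMeasure (spectralFunctional hT v)

instance (hT : IsSelfAdjoint T) (v : H) : (spectralMeasure hT v).Regular :=
  RealRMK.regular_rieszMeasure _

theorem integral_ofReal_spectralMeasure (hT : IsSelfAdjoint T) (v : H) {f : ℝ → ℝ}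
    (hf : Continuous f) (hc : HasCompactSupport f) :
    ∫ x, f x ∂(spectralMeasure hT v) = (⟪v, funCalc T (fun x => (f x : ℂ)) v⟫_ℂ).re :=
  RealRMK.integral_rieszMeasure (spectralFunctional hT v) ⟨⟨f, hf⟩, hc⟩

/-- Monotone convergence along the cutoffs, which tend strongly to the identity. The full mass ‖v‖²
later gives both E(ℝ) = 1 and contractivity of the projections. -/
theorem spectralMeasure_univ (hT : IsSelfAdjoint T) (v : H) :
    spectralMeasure hT v Set.univ = ENNReal.ofReal (‖v‖ ^ 2) := by
  have h1 : Tendsto (fun n => ∫⁻ x, ENNReal.ofReal (cutoff n x) ∂(spectralMeasure hT v)) atTop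
      (𝓝 (∫⁻ _, 1 ∂(spectralMeasure hT v))) := by
    refine lintegral_tendsto_of_tendsto_of_monotone
      (fun n => (continuous_cutoff n).measurable.ennreal_ofReal.aemeasurable)
      (Eventually.of_forall fun x n m hnm => ?_) (Eventually.of_forall fun x => ?_)
    · refine ENNReal.ofReal_le_ofReal (max_le_max le_rfl (min_le_min le_rfl ?_))
      gcongr
    · obtain ⟨N, hN⟩ := exists_nat_ge |x|
      refine tendsto_const_nhds.congr' ?_
      filter_upwards [eventually_ge_atTop N] with n hn
      rw [cutoff_eq_one (hN.trans (by exact_mod_cast hn)), ENNReal.ofReal_one]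
  have h2 : ∀ n, ∫⁻ x, ENNReal.ofReal (cutoff n x) ∂(spectralMeasure hT v) =
      ENNReal.ofReal (⟪v, funCalc T (fun x => (cutoff n x : ℂ)) v⟫_ℂ).re := fun n => by
    rw [← integral_ofReal_spectralMeasure hT v (continuous_cutoff n) (hasCompactSupport_cutoff n),
      ofReal_integral_eq_lintegral_ofReal
        ((continuous_cutoff n).integrable_of_hasCompactSupport (hasCompactSupport_cutoff n))
        (Eventually.of_forall (cutoff_nonneg n))]
  have h3 : Tendsto (fun n => ENNReal.ofReal
      (⟪v, funCalc T (fun x => (cutoff n x : ℂ)) v⟫_ℂ).re) atTop (𝓝 (ENNReal.ofReal (‖v‖ ^ 2))) := by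
    refine ENNReal.tendsto_ofReal ?_
    have h4 := (tendsto_const_nhds (x := v)).inner (𝕜 := ℂ) (tendsto_funCalc_cutoff hT v)
    have h5 := (Complex.continuous_re.tendsto _).comp h4
    rwa [show (⟪v, v⟫_ℂ).re = ‖v‖ ^ 2 from inner_self_eq_norm_sq (𝕜 := ℂ) v] at h5
  simp_rw [h2] at h1
  rw [← tendsto_nhds_unique h1 h3, lintegral_one]

instance (hT : IsSelfAdjoint T) (v : H) : IsFiniteMeasure (spectralMeasure hT v) :=
  ⟨by rw [spectralMeasure_univ]; exact ENNReal.ofReal_lt_top⟩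

theorem integral_spectralMeasure (hT : IsSelfAdjoint T) (v : H) {f : ℝ → ℂ}
    (hf : Continuous f) (hc : HasCompactSupport f) :
    ∫ x, f x ∂(spectralMeasure hT v) = ⟪v, funCalc T f v⟫_ℂ := by
  have hr : Continuous fun x => (f x).re := Complex.continuous_re.comp hf
  have hi : Continuous fun x => (f x).im := Complex.continuous_im.comp hf
  have hrc : HasCompactSupport fun x => (f x).re := hc.comp_left (g := Complex.re) Complex.zero_re
  have hic : HasCompactSupport fun x => (f x).im := hc.comp_left (g := Complex.im) Complex.zero_im
  have h : f = (fun x => ((f x).re : ℂ)) + Complex.I • fun x => ((f x).im : ℂ) := by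
    funext x
    simp [mul_comm Complex.I]
  have hic' := hasCompactSupport_ofReal_comp hic
  rw [← integral_re_add_im (hf.integrable_of_hasCompactSupport hc)]
  conv_rhs => rw [h]
  rw [funCalc_add hT (continuous_ofReal_comp hr) (hasCompactSupport_ofReal_comp hrc)
    ((continuous_ofReal_comp hi).const_smul _) (hic'.smul_left (f := fun _ => Complex.I)),
    funCalc_smul hT _ (continuous_ofReal_comp hi) hic', add_apply,
    smul_apply, inner_add_right, inner_smul_right, inner_funCalc_ofReal T fun x => (f x).re,
    inner_funCalc_ofReal T fun x => (f x).im, ← integral_ofReal_spectralMeasure hT v hr hrc,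
    ← integral_ofReal_spectralMeasure hT v hi hic, mul_comm Complex.I]
  rfl

/-- ‖f(T)v‖² = ⟪v, (|f|²)(T)v⟫ is the integral of |f|². This isometry is what extends the calculus
from C_c to indicators. -/
theorem enorm_funCalc_apply (hT : IsSelfAdjoint T) (v : H) {f : ℝ → ℂ}
    (hf : Continuous f) (hc : HasCompactSupport f) :
    ‖funCalc T f v‖ₑ = eLpNorm f 2 (spectralMeasure hT v) := by
  have hc' : HasCompactSupport (star f) := hc.comp_left (g := star) (star_zero ℂ)
  have hf' : Continuous (star f) := continuous_star_comp hf
  have h1 : ((‖funCalc T f v‖ ^ 2 : ℝ) : ℂ) = ∫ x, ((‖f x‖ ^ 2 : ℝ) : ℂ) ∂(spectralMeasure hT v) := by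
    have h := inner_self_eq_norm_sq_to_K (𝕜 := ℂ) (funCalc T f v)
    rw [inner_funCalc_star, ← mul_apply_eq_comp, ← funCalc_mul hT hf' hc' hf hc,
      ← integral_spectralMeasure hT v (hf'.mul hf) hc.mul_left] at h
    rw [Complex.ofReal_pow]
    refine h.symm.trans (integral_congr_ae (Eventually.of_forall fun x => ?_))
    simp [Complex.conj_mul']
  rw [integral_complex_ofReal, Complex.ofReal_inj] at h1
  rw [(hf.memLp_of_hasCompactSupport hc).eLpNorm_eq_integral_rpow_norm two_ne_zero (by simp)]
  simp only [ENNReal.toReal_ofNat, Real.rpow_two]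
  rw [← h1, ← Real.rpow_natCast, ← Real.rpow_mul (norm_nonneg _), ← ofReal_norm]
  norm_num

end SpectralMeasure

/-! ### Spectral projections by L² approximation of indicators. -/

section SpectralProjection

open Filter Topology MeasureTheory
open scoped ENNReal

/-- The indicator function of a set of real numbers, with complex values. -/
noncomputable def indicatorC (B : Set ℝ) : ℝ → ℂ := B.indicator fun _ => 1

theorem measurable_indicatorC {B : Set ℝ} (hB : MeasurableSet B) : Measurable (indicatorC B) :=
  measurable_const.indicator hB

theorem indicatorC_inter (A B : Set ℝ) : indicatorC (A ∩ B) = indicatorC A * indicatorC B := by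
  funext x
  classical
  simp only [indicatorC, Pi.mul_apply, Set.indicator_apply, Set.mem_inter_iff]
  split_ifs <;> simp_all

theorem norm_indicatorC_le (B : Set ℝ) (x : ℝ) : ‖indicatorC B x‖ ≤ 1 := by
  classical
  simp only [indicatorC, Set.indicator_apply]
  split_ifs <;> simp

theorem exists_seq_tendsto_indicator (ν : Measure ℝ) [IsFiniteMeasure ν] {B : Set ℝ}
    (hB : MeasurableSet B) : ∃ f : ℕ → ℝ → ℝ, ∀ n, Continuous (f n) ∧ HasCompactSupport (f n) ∧
      eLpNorm ((fun x => (f n x : ℂ)) - indicatorC B) 2 ν ≤ (2 ^ n)⁻¹ := by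
  have hm : MemLp (B.indicator fun _ => (1 : ℝ)) 2 ν :=
    memLp_indicator_const 2 hB 1 (Or.inr (measure_ne_top ν B))
  have h : ∀ n : ℕ, ∃ f : ℝ → ℝ, Continuous f ∧ HasCompactSupport f ∧
      eLpNorm ((fun x => (f x : ℂ)) - indicatorC B) 2 ν ≤ (2 ^ n)⁻¹ := fun n => by
    obtain ⟨g, hgs, hg, hgc, -⟩ := hm.exists_hasCompactSupport_eLpNorm_sub_le (by simp)
      (ε := (2 ^ n)⁻¹) (by simp)
    refine ⟨g, hgc, hgs, le_trans (le_of_eq (eLpNorm_congr_norm_ae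
      (Eventually.of_forall fun x => ?_))) hg⟩
    classical
    simp only [Pi.sub_apply, indicatorC, Set.indicator_apply]
    split_ifs
    · rw [← Complex.ofReal_one, ← Complex.ofReal_sub, Complex.norm_real, norm_sub_rev]
    · rw [sub_zero, Complex.norm_real, zero_sub, norm_neg]
  choose f hf using h
  exact ⟨f, hf⟩

theorem tendsto_inv_two_pow : Tendsto (fun n : ℕ => ((2 : ℝ≥0∞) ^ n)⁻¹) atTop (𝓝 0) := by
  simp_rw [ENNReal.inv_pow]
  exact ENNReal.tendsto_pow_atTop_nhds_zero_of_lt_one (by simp)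

theorem aestronglyMeasurable_indicatorC {B : Set ℝ} (hB : MeasurableSet B) (ν : Measure ℝ) :
    AEStronglyMeasurable (indicatorC B) ν :=
  (measurable_indicatorC hB).aestronglyMeasurable

variable {H : Type*} [NormedAddCommGroup H] [InnerProductSpace ℂ H] [CompleteSpace H]
  {T : H →ₗ.[ℂ] H}

theorem funCalc_sub (hT : IsSelfAdjoint T) {f g : ℝ → ℂ} (hf : Continuous f)
    (hcf : HasCompactSupport f) (hg : Continuous g) (hcg : HasCompactSupport g) :
    funCalc T (f - g) = funCalc T f - funCalc T g := by
  have h := funCalc_add hT hf hcf (hg.const_smul (-1 : ℂ))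
    (hcg.smul_left (f := fun _ => (-1 : ℂ)))
  rw [funCalc_smul hT _ hg hcg] at h
  rw [show f - g = f + (-1 : ℂ) • g by simp [sub_eq_add_neg], h]
  simp [sub_eq_add_neg]

/-- By the isometry, approximants of the indicator in L² give a Cauchy sequence in H. Stating the
estimate for every f makes the limit y independent of the approximating sequence. -/
theorem exists_spectralProj_apply (hT : IsSelfAdjoint T) {B : Set ℝ} (hB : MeasurableSet B)
    (v : H) : ∃ y : H, ∀ f : ℝ → ℂ, Continuous f → HasCompactSupport f →
      ‖funCalc T f v - y‖ₑ ≤ eLpNorm (f - indicatorC B) 2 (spectralMeasure hT v) := by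
  obtain ⟨g, hg⟩ := exists_seq_tendsto_indicator (spectralMeasure hT v) hB
  have hgc := fun n => continuous_ofReal_comp (hg n).1
  have hgs := fun n => hasCompactSupport_ofReal_comp (hg n).2.1
  have hm := aestronglyMeasurable_indicatorC hB (spectralMeasure hT v)
  set G : ℕ → ℝ → ℂ := fun n x => (g n x : ℂ) with hG
  have hdist : ∀ (f : ℝ → ℂ), Continuous f → HasCompactSupport f → ∀ n,
      ‖funCalc T f v - funCalc T (G n) v‖ₑ ≤
        eLpNorm (f - indicatorC B) 2 (spectralMeasure hT v) + (2 ^ n)⁻¹ := fun f hf hc n => by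
    rw [← sub_apply, ← funCalc_sub hT hf hc (hgc n) (hgs n),
      enorm_funCalc_apply hT v (hf.sub (hgc n)) (hc.sub (hgs n)),
      show f - G n = (f - indicatorC B) - (G n - indicatorC B) by abel]
    refine (eLpNorm_sub_le (hf.aestronglyMeasurable.sub hm)
      ((hgc n).aestronglyMeasurable.sub hm) (by norm_num)).trans ?_
    gcongr
    exact (hg n).2.2
  have hcauchy : CauchySeq fun n => funCalc T (G n) v := by
    -- The constant 2 covers the two errors, at n and at n + 1, each at most 2⁻ⁿ.
    refine cauchySeq_of_edist_le_geometric_two 2 (by simp) fun n => ?_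
    rw [edist_eq_enorm_sub]
    refine (hdist _ (hgc n) (hgs n) (n + 1)).trans ?_
    have h1 : ((2 : ℝ≥0∞) ^ (n + 1))⁻¹ ≤ (2 ^ n)⁻¹ :=
      ENNReal.inv_le_inv.2 (pow_le_pow_right₀ (by norm_num) (by omega))
    refine (add_le_add (hg n).2.2 h1).trans ?_
    rw [div_eq_mul_inv, two_mul]
  obtain ⟨y, hy⟩ := cauchySeq_tendsto_of_complete hcauchy
  refine ⟨y, fun f hf hc => ?_⟩
  have h1 : Tendsto (fun n => ‖funCalc T f v - funCalc T (G n) v‖ₑ) atTop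
      (𝓝 ‖funCalc T f v - y‖ₑ) := (tendsto_const_nhds.sub hy).enorm
  have h2 : Tendsto (fun n => eLpNorm (f - indicatorC B) 2 (spectralMeasure hT v) +
      ((2 : ℝ≥0∞) ^ n)⁻¹) atTop (𝓝 (eLpNorm (f - indicatorC B) 2 (spectralMeasure hT v) + 0)) :=
    tendsto_const_nhds.add tendsto_inv_two_pow
  rw [add_zero] at h2
  exact le_of_tendsto_of_tendsto' h1 h2 (hdist f hf hc)

/-- The value at `v` of the spectral projection of `T` for the Borel set `B`. -/
noncomputable def spectralProjAux (hT : IsSelfAdjoint T) {B : Set ℝ} (hB : MeasurableSet B)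
    (v : H) : H :=
  (exists_spectralProj_apply hT hB v).choose

theorem enorm_funCalc_sub_spectralProjAux_le (hT : IsSelfAdjoint T) {B : Set ℝ}
    (hB : MeasurableSet B) (v : H) {f : ℝ → ℂ} (hf : Continuous f) (hc : HasCompactSupport f) :
    ‖funCalc T f v - spectralProjAux hT hB v‖ₑ ≤
      eLpNorm (f - indicatorC B) 2 (spectralMeasure hT v) :=
  (exists_spectralProj_apply hT hB v).choose_spec f hf hc

theorem tendsto_spectralProjAux (hT : IsSelfAdjoint T) {B : Set ℝ}
    (hB : MeasurableSet B) (v : H) {ν : Measure ℝ} (hν : spectralMeasure hT v ≤ ν)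
    {f : ℕ → ℝ → ℝ} (hf : ∀ n, Continuous (f n) ∧ HasCompactSupport (f n) ∧
      eLpNorm ((fun x => (f n x : ℂ)) - indicatorC B) 2 ν ≤ (2 ^ n)⁻¹) :
    Tendsto (fun n => funCalc T (fun x => (f n x : ℂ)) v) atTop (𝓝 (spectralProjAux hT hB v)) := by
  rw [tendsto_iff_edist_tendsto_0]
  refine tendsto_of_tendsto_of_tendsto_of_le_of_le tendsto_const_nhds tendsto_inv_two_pow
    (fun _ => zero_le) fun n => ?_
  rw [edist_eq_enorm_sub]
  exact (enorm_funCalc_sub_spectralProjAux_le hT hB v (continuous_ofReal_comp (hf n).1)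
    (hasCompactSupport_ofReal_comp (hf n).2.1)).trans
    ((eLpNorm_mono_measure _ hν).trans (hf n).2.2)

theorem enorm_spectralProjAux (hT : IsSelfAdjoint T) {B : Set ℝ} (hB : MeasurableSet B) (v : H) :
    ‖spectralProjAux hT hB v‖ₑ = eLpNorm (indicatorC B) 2 (spectralMeasure hT v) := by
  obtain ⟨f, hf⟩ := exists_seq_tendsto_indicator (spectralMeasure hT v) hB
  have h1 := (tendsto_spectralProjAux hT hB v le_rfl hf).enorm
  have hm := aestronglyMeasurable_indicatorC hB (spectralMeasure hT v)
  have hfm : ∀ n, AEStronglyMeasurable (fun x => (f n x : ℂ)) (spectralMeasure hT v) :=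
    fun n => (continuous_ofReal_comp (hf n).1).aestronglyMeasurable
  have h2 : ∀ n, ‖funCalc T (fun x => (f n x : ℂ)) v‖ₑ =
      eLpNorm (fun x => (f n x : ℂ)) 2 (spectralMeasure hT v) := fun n =>
    enorm_funCalc_apply hT v (continuous_ofReal_comp (hf n).1)
      (hasCompactSupport_ofReal_comp (hf n).2.1)
  simp_rw [h2] at h1
  refine le_antisymm ?_ ?_
  · have h3 : Tendsto (fun n => eLpNorm (indicatorC B) 2 (spectralMeasure hT v) +
      ((2 : ℝ≥0∞) ^ n)⁻¹) atTop (𝓝 (eLpNorm (indicatorC B) 2 (spectralMeasure hT v) + 0)) :=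
      tendsto_const_nhds.add tendsto_inv_two_pow
    rw [add_zero] at h3
    refine le_of_tendsto_of_tendsto' h1 h3 fun n => ?_
    have h4 := eLpNorm_add_le hm ((hfm n).sub hm) (p := 2) (by norm_num)
    rw [add_sub_cancel] at h4
    exact h4.trans (add_le_add_right (hf n).2.2 _)
  · have h3 := h1.add tendsto_inv_two_pow
    rw [add_zero] at h3
    refine ge_of_tendsto' h3 fun n => ?_
    have h4 := eLpNorm_sub_le (hfm n) ((hfm n).sub hm) (p := 2) (by norm_num)
    rw [sub_sub_cancel] at h4
    exact h4.trans (add_le_add_right (hf n).2.2 _)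

theorem norm_sq_spectralProjAux (hT : IsSelfAdjoint T) {B : Set ℝ} (hB : MeasurableSet B) (v : H) :
    ‖spectralProjAux hT hB v‖ ^ 2 = (spectralMeasure hT v).real B := by
  have h := enorm_spectralProjAux hT hB v
  rw [indicatorC, eLpNorm_indicator_const hB two_ne_zero (by simp), enorm_one, one_mul] at h
  have h2 := congrArg (fun x => (x ^ 2).toReal) h
  simp only [ENNReal.toReal_ofNat, ENNReal.toReal_pow, toReal_enorm] at h2
  rw [h2, ← ENNReal.toReal_pow, ← ENNReal.rpow_natCast, ← ENNReal.rpow_mul]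
  norm_num [Measure.real]

/-- The spectral projection of the self-adjoint operator `T` for the Borel set `B`. -/
noncomputable def spectralProj (hT : IsSelfAdjoint T) {B : Set ℝ} (hB : MeasurableSet B) :
    H →L[ℂ] H :=
  LinearMap.mkContinuous
    { toFun := spectralProjAux hT hB
      map_add' := fun v w => by
        -- A sum of measures dominates each of them, so one sequence f serves v, w and v + w, and
        -- additivity passes to the limit.
        obtain ⟨f, hf⟩ := exists_seq_tendsto_indicator
          (spectralMeasure hT v + spectralMeasure hT w + spectralMeasure hT (v + w)) hB
        have h1 := tendsto_spectralProjAux hT hB (v + w) (Measure.le_add_left le_rfl) hf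
        have h2 := tendsto_spectralProjAux hT hB v
          (Measure.le_add_right (Measure.le_add_right le_rfl)) hf
        have h3 := tendsto_spectralProjAux hT hB w
          (Measure.le_add_right (Measure.le_add_left le_rfl)) hf
        simp_rw [map_add] at h1
        exact tendsto_nhds_unique h1 (h2.add h3)
      map_smul' := fun c v => by
        obtain ⟨f, hf⟩ := exists_seq_tendsto_indicator
          (spectralMeasure hT v + spectralMeasure hT (c • v)) hB
        have h1 := tendsto_spectralProjAux hT hB (c • v) (Measure.le_add_left le_rfl) hf
        have h2 := tendsto_spectralProjAux hT hB v (Measure.le_add_right le_rfl) hf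
        simp_rw [map_smul] at h1
        exact tendsto_nhds_unique h1 (h2.const_smul c) }
    1 fun v => by
      rw [one_mul, ← sq_le_sq₀ (norm_nonneg _) (norm_nonneg _)]
      change ‖spectralProjAux hT hB v‖ ^ 2 ≤ _
      rw [norm_sq_spectralProjAux]
      refine (measureReal_mono (Set.subset_univ B)).trans ?_
      rw [measureReal_def, spectralMeasure_univ, ENNReal.toReal_ofReal (sq_nonneg _)]

theorem norm_sq_spectralProj (hT : IsSelfAdjoint T) {B : Set ℝ} (hB : MeasurableSet B) (v : H) :
    ‖spectralProj hT hB v‖ ^ 2 = (spectralMeasure hT v).real B :=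
  norm_sq_spectralProjAux hT hB v

theorem inner_spectralProj_left (hT : IsSelfAdjoint T) {B : Set ℝ} (hB : MeasurableSet B)
    (v w : H) : ⟪spectralProj hT hB v, w⟫_ℂ = ⟪v, spectralProj hT hB w⟫_ℂ := by
  obtain ⟨f, hf⟩ := exists_seq_tendsto_indicator (spectralMeasure hT v + spectralMeasure hT w) hB
  have h1 := tendsto_spectralProjAux hT hB v (Measure.le_add_right le_rfl) hf
  have h2 := tendsto_spectralProjAux hT hB w (Measure.le_add_left le_rfl) hf
  have h3 := h1.inner (𝕜 := ℂ) (tendsto_const_nhds (x := w))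
  simp_rw [inner_funCalc_star, star_ofReal_comp] at h3
  exact tendsto_nhds_unique h3 ((tendsto_const_nhds (x := v)).inner h2)

/-- The product f g of approximants differs from the indicator of A ∩ B by f (g - 1_B) + (f - 1_A)
1_B. -/
theorem spectralProj_inter (hT : IsSelfAdjoint T) {A B : Set ℝ} (hA : MeasurableSet A)
    (hB : MeasurableSet B) :
    spectralProj hT (hA.inter hB) = spectralProj hT hA * spectralProj hT hB := by
  ext v
  set u := spectralProj hT hB v
  obtain ⟨f, hf⟩ := exists_seq_tendsto_indicator (spectralMeasure hT v + spectralMeasure hT u) hA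
  obtain ⟨g, hg⟩ := exists_seq_tendsto_indicator (spectralMeasure hT v) hB
  have hfu := tendsto_spectralProjAux hT hA u (Measure.le_add_left le_rfl) hf
  have hgv := tendsto_spectralProjAux hT hB v le_rfl hg
  refine tendsto_nhds_unique ?_ hfu
  rw [tendsto_iff_edist_tendsto_0]
  refine tendsto_of_tendsto_of_tendsto_of_le_of_le tendsto_const_nhds tendsto_inv_two_pow
    (fun _ => zero_le) fun n => ?_
  rw [edist_eq_enorm_sub]
  have hfc := continuous_ofReal_comp (hf n).1
  have hfs := hasCompactSupport_ofReal_comp (hf n).2.1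
  have hmA := aestronglyMeasurable_indicatorC hA (spectralMeasure hT v)
  have hmB := aestronglyMeasurable_indicatorC hB (spectralMeasure hT v)
  -- C depends on n, which is harmless since m tends to infinity first, with n fixed.
  obtain ⟨C, hC⟩ := hfs.exists_bound_of_continuous hfc
  have h1 : Tendsto (fun m => ‖funCalc T (fun x => (f n x : ℂ)) (funCalc T (fun x => (g m x : ℂ)) v)
      - spectralProj hT (hA.inter hB) v‖ₑ) atTop
      (𝓝 ‖funCalc T (fun x => (f n x : ℂ)) u - spectralProj hT (hA.inter hB) v‖ₑ) :=
    ((((funCalc T (fun x => (f n x : ℂ))).continuous.tendsto _).comp hgv).sub_const _).enorm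
  have h2 : Tendsto (fun m : ℕ => ENNReal.ofReal C * ((2 : ℝ≥0∞) ^ m)⁻¹ + (2 ^ n)⁻¹) atTop
      (𝓝 (ENNReal.ofReal C * 0 + (2 ^ n)⁻¹)) :=
    (ENNReal.Tendsto.const_mul tendsto_inv_two_pow (Or.inr ENNReal.ofReal_ne_top)).add_const _
  rw [mul_zero, zero_add] at h2
  refine le_of_tendsto_of_tendsto' h1 h2 fun m => ?_
  have hgc := continuous_ofReal_comp (hg m).1
  have hgs := hasCompactSupport_ofReal_comp (hg m).2.1
  rw [← mul_apply_eq_comp, ← funCalc_mul hT hfc hfs hgc hgs]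
  refine (enorm_funCalc_sub_spectralProjAux_le hT (hA.inter hB) v (hfc.mul hgc)
    hfs.mul_right).trans ?_
  have h3 : (fun x => (f n x : ℂ)) * (fun x => (g m x : ℂ)) - indicatorC (A ∩ B) =
      (fun x => (f n x : ℂ)) * ((fun x => (g m x : ℂ)) - indicatorC B) +
        ((fun x => (f n x : ℂ)) - indicatorC A) * indicatorC B := by
    rw [indicatorC_inter]; ring
  rw [h3]
  refine (eLpNorm_add_le (hfc.aestronglyMeasurable.mul (hgc.aestronglyMeasurable.sub hmB))
    ((hfc.aestronglyMeasurable.sub hmA).mul hmB) (by norm_num)).trans (add_le_add ?_ ?_)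
  · refine (eLpNorm_le_mul_eLpNorm_of_ae_le_mul (c := C)
      (g := (fun x => (g m x : ℂ)) - indicatorC B) (Eventually.of_forall fun x => ?_) 2).trans ?_
    · rw [Pi.mul_apply, norm_mul]
      exact mul_le_mul_of_nonneg_right (hC x) (norm_nonneg _)
    · gcongr
      exact (hg m).2.2
  · refine le_trans (eLpNorm_mono fun x => ?_) ((eLpNorm_mono_measure _
      (Measure.le_add_right le_rfl)).trans (hf n).2.2)
    rw [Pi.mul_apply, norm_mul]
    exact mul_le_of_le_one_right (norm_nonneg _) (norm_indicatorC_le B x)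

end SpectralProjection

/-! ### The spectral resolution, and orbits in terms of it. -/

section SpectralResolution

open Filter Topology MeasureTheory
open scoped ENNReal

variable {H : Type*} [NormedAddCommGroup H] [InnerProductSpace ℂ H] [CompleteSpace H]
  {T : H →ₗ.[ℂ] H}

theorem isStarProjection_spectralProj (hT : IsSelfAdjoint T) {B : Set ℝ} (hB : MeasurableSet B) :
    IsStarProjection (spectralProj hT hB) := by
  refine ⟨?_, ?_⟩
  · have h := spectralProj_inter hT hB hB
    simp only [Set.inter_self] at h
    exact h.symm
  · rw [ContinuousLinearMap.isSelfAdjoint_iff_isSymmetric]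
    exact fun v w => inner_spectralProj_left hT hB v w

theorem inner_spectralProj_self (hT : IsSelfAdjoint T) {B : Set ℝ} (hB : MeasurableSet B) (v : H) :
    ⟪v, spectralProj hT hB v⟫_ℂ = ((‖spectralProj hT hB v‖ ^ 2 : ℝ) : ℂ) := by
  have h := DFunLike.congr_fun (isStarProjection_spectralProj hT hB).isIdempotentElem.eq v
  rw [mul_apply_eq_comp] at h
  nth_rw 1 [← h]
  rw [← inner_spectralProj_left, inner_self_eq_norm_sq_to_K]
  norm_cast

theorem spectralProj_empty (hT : IsSelfAdjoint T) : spectralProj hT MeasurableSet.empty = 0 := by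
  ext v
  have h := norm_sq_spectralProj hT MeasurableSet.empty v
  rw [measureReal_empty] at h
  simpa using h

theorem spectralProj_univ (hT : IsSelfAdjoint T) : spectralProj hT MeasurableSet.univ = 1 := by
  ext v
  have h := norm_sq_spectralProj hT MeasurableSet.univ v
  rw [measureReal_def, spectralMeasure_univ, ENNReal.toReal_ofReal (sq_nonneg _)] at h
  have h2 := inner_spectralProj_self hT MeasurableSet.univ v
  -- ‖Ev‖² and ⟪v, Ev⟫ both equal ‖v‖², so the distance from v to Ev vanishes.
  have h3 := norm_sub_sq (𝕜 := ℂ) v (spectralProj hT MeasurableSet.univ v)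
  rw [h2, RCLike.re_eq_complex_re, Complex.ofReal_re, h] at h3
  have h4 : ‖v - spectralProj hT MeasurableSet.univ v‖ ^ 2 = 0 := by rw [h3]; ring
  exact (sub_eq_zero.1 (norm_eq_zero.1 (pow_eq_zero_iff two_ne_zero |>.1 h4))).symm

theorem hasSum_measureReal_iUnion {μ : Measure ℝ} [IsFiniteMeasure μ] {B : ℕ → Set ℝ}
    (hB : ∀ n, MeasurableSet (B n)) (hd : Pairwise fun m n => Disjoint (B m) (B n)) :
    HasSum (fun n => μ.real (B n)) (μ.real (⋃ n, B n)) := by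
  have h := measure_iUnion hd hB (μ := μ)
  have h1 : ∑' n, μ (B n) ≠ ∞ := by rw [← h]; exact measure_ne_top _ _
  rw [measureReal_def, h, ENNReal.tsum_toReal_eq fun n => measure_ne_top _ _]
  exact ENNReal.hasSum_toReal h1

theorem hasSum_spectralProj (hT : IsSelfAdjoint T) {B : ℕ → Set ℝ}
    (hB : ∀ n, MeasurableSet (B n)) (hd : Pairwise fun m n => Disjoint (B m) (B n)) (v : H) :
    HasSum (fun n => spectralProj hT (hB n) v) (spectralProj hT (MeasurableSet.iUnion hB) v) := by
  set w := spectralProj hT (MeasurableSet.iUnion hB) v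
  have hmul : ∀ {A C D : Set ℝ} (hA : MeasurableSet A) (hC : MeasurableSet C)
      (hD : MeasurableSet D), A ∩ C = D → ⟪spectralProj hT hA v, spectralProj hT hC v⟫_ℂ =
        ((‖spectralProj hT hD v‖ ^ 2 : ℝ) : ℂ) := by
    rintro A C _ hA hC hD rfl
    rw [inner_spectralProj_left, ← mul_apply_eq_comp, ← spectralProj_inter,
      inner_spectralProj_self]
  have horth : ∀ m n, m ≠ n → ⟪spectralProj hT (hB m) v, spectralProj hT (hB n) v⟫_ℂ = 0 := by
    intro m n hmn
    rw [hmul (hB m) (hB n) MeasurableSet.empty (hd hmn).inter_eq, spectralProj_empty]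
    simp
  have hw : ∀ n, ⟪spectralProj hT (hB n) v, w⟫_ℂ = ((‖spectralProj hT (hB n) v‖ ^ 2 : ℝ) : ℂ) :=
    fun n => hmul _ _ _ (Set.inter_eq_left.2 (Set.subset_iUnion B n))
  -- Pythagoras for orthogonal pieces turns strong convergence into countable additivity of the
  -- scalar measure.
  have hnorm : ∀ s : Finset ℕ, ‖w - ∑ n ∈ s, spectralProj hT (hB n) v‖ ^ 2 =
      (spectralMeasure hT v).real (⋃ n, B n) - ∑ n ∈ s, (spectralMeasure hT v).real (B n) := by
    intro s
    set d := w - ∑ n ∈ s, spectralProj hT (hB n) v with hdd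
    have h1 : ∀ n ∈ s, ⟪spectralProj hT (hB n) v, d⟫_ℂ = 0 := fun n hn => by
      rw [hdd, inner_sub_right, hw, inner_sum, Finset.sum_eq_single_of_mem n hn
        fun m _ hmn => horth n m hmn.symm, hmul (hB n) (hB n) (hB n) (Set.inter_self _), sub_self]
    have h2 : ⟪d, d⟫_ℂ = ((‖w‖ ^ 2 - ∑ n ∈ s, ‖spectralProj hT (hB n) v‖ ^ 2 : ℝ) : ℂ) := by
      nth_rw 1 [hdd]
      rw [inner_sub_left, sum_inner, Finset.sum_eq_zero h1, sub_zero, hdd, inner_sub_right,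
        inner_sum, inner_self_eq_norm_sq_to_K, Complex.ofReal_sub, Complex.ofReal_sum]
      congr 1
      · norm_cast
      · refine Finset.sum_congr rfl fun n _ => ?_
        rw [← inner_conj_symm, hw, Complex.conj_ofReal]
    have h3 : ‖d‖ ^ 2 = ‖w‖ ^ 2 - ∑ n ∈ s, ‖spectralProj hT (hB n) v‖ ^ 2 :=
      (inner_self_eq_norm_sq (𝕜 := ℂ) d).symm.trans
        ((congrArg Complex.re h2).trans (Complex.ofReal_re _))
    simp_rw [h3, norm_sq_spectralProj]
    rw [show ‖w‖ ^ 2 = _ from norm_sq_spectralProj hT (MeasurableSet.iUnion hB) v]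
  have h1 := (hasSum_measureReal_iUnion (μ := spectralMeasure hT v) hB hd).const_sub
    ((spectralMeasure hT v).real (⋃ n, B n))
  rw [sub_self] at h1
  simp_rw [← hnorm] at h1
  have h2 := (Real.continuous_sqrt.tendsto 0).comp h1
  rw [HasSum, tendsto_iff_norm_sub_tendsto_zero]
  rw [Real.sqrt_zero] at h2
  refine h2.congr fun s => ?_
  rw [Function.comp_apply, Real.sqrt_sq (norm_nonneg _), norm_sub_rev]

open scoped Classical in
/-- The spectral resolution of the identity of a self-adjoint operator. -/
noncomputable def spectralResolution (hT : IsSelfAdjoint T) : ProjectionValuedMeasure H where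
  proj B := if hB : MeasurableSet B then spectralProj hT hB else 0
  isStarProjection B hB := by
    rw [dif_pos hB]
    exact isStarProjection_spectralProj hT hB
  proj_empty := by rw [dif_pos MeasurableSet.empty, spectralProj_empty]
  proj_univ := by rw [dif_pos MeasurableSet.univ, spectralProj_univ]
  proj_inter A B hA hB := by
    rw [dif_pos hA, dif_pos hB, dif_pos (hA.inter hB), spectralProj_inter]
  hasSum_proj B hB hd v := by
    simp_rw [dif_pos (hB _), dif_pos (MeasurableSet.iUnion hB)]
    exact hasSum_spectralProj hT hB hd v

theorem spectralResolution_proj (hT : IsSelfAdjoint T) {B : Set ℝ} (hB : MeasurableSet B) :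
    (spectralResolution hT).proj B = spectralProj hT hB :=
  dif_pos hB

theorem ProjectionValuedMeasure.measure_apply (E : ProjectionValuedMeasure H) (v : H) {B : Set ℝ}
    (hB : MeasurableSet B) : E.measure v B = ENNReal.ofReal (⟪v, E.proj B v⟫_ℂ).re :=
  Measure.ofMeasurable_apply B hB

instance (E : ProjectionValuedMeasure H) (v : H) : IsFiniteMeasure (E.measure v) :=
  ⟨by rw [E.measure_apply v MeasurableSet.univ]; exact ENNReal.ofReal_lt_top⟩

theorem isSpectralResolution_spectralResolution (hT : IsSelfAdjoint T) :
    IsSpectralResolution T (spectralResolution hT) := by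
  intro f hf hc v
  have h : (spectralResolution hT).measure v = spectralMeasure hT v := by
    ext B hB
    rw [ProjectionValuedMeasure.measure_apply _ _ hB, spectralResolution_proj hT hB,
      inner_spectralProj_self, Complex.ofReal_re, norm_sq_spectralProj, ofReal_measureReal]
  rw [h, integral_spectralMeasure hT v hf hc]

theorem ProjectionValuedMeasure.inner_proj_left (E : ProjectionValuedMeasure H) {B : Set ℝ}
    (hB : MeasurableSet B) (v w : H) : ⟪E.proj B v, w⟫_ℂ = ⟪v, E.proj B w⟫_ℂ :=
  (ContinuousLinearMap.isSelfAdjoint_iff_isSymmetric.1 (E.isStarProjection B hB).isSelfAdjoint) v w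

theorem ProjectionValuedMeasure.inner_proj_self (E : ProjectionValuedMeasure H) {B : Set ℝ}
    (hB : MeasurableSet B) (v : H) : ⟪v, E.proj B v⟫_ℂ = ((E.measure v).real B : ℂ) := by
  have h := DFunLike.congr_fun (E.isStarProjection B hB).isIdempotentElem.eq v
  have h1 : ⟪v, E.proj B v⟫_ℂ = ((‖E.proj B v‖ ^ 2 : ℝ) : ℂ) := by
    rw [mul_apply_eq_comp] at h
    nth_rw 1 [← h]
    rw [← E.inner_proj_left hB, inner_self_eq_norm_sq_to_K]
    norm_cast
  rw [measureReal_def, E.measure_apply v hB, h1, Complex.ofReal_re,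
    ENNReal.toReal_ofReal (sq_nonneg _)]

/-- If the quadratic form of `A` does not change under the reflection in `K`, then `K` is
invariant under `A`. -/
theorem apply_mem_of_inner_reflection {A : H →L[ℂ] H} {K : Submodule ℂ H}
    (hK : IsClosed (K : Set H))
    (h : ∀ w ∈ K, ∀ u ∈ Kᗮ, ⟪w + u, A (w + u)⟫_ℂ = ⟪w - u, A (w - u)⟫_ℂ) {w : H} (hw : w ∈ K) :
    A w ∈ K := by
  have : CompleteSpace K := hK.completeSpace_coe
  rw [← K.orthogonal_orthogonal, Submodule.mem_orthogonal]
  intro u hu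
  have h1 := h w hw u hu
  -- For u the sum of the two cross terms vanishes, for iu their difference; hence ⟪u, A w⟫ = 0.
  have h2 := h w hw (Complex.I • u) (Kᗮ.smul_mem _ hu)
  simp only [map_add, map_sub, map_smul, inner_add_left, inner_add_right, inner_sub_left,
    inner_sub_right, inner_smul_left, inner_smul_right, Complex.conj_I] at h1 h2
  have h3 : 4 * ⟪u, A w⟫_ℂ = 0 := by
    linear_combination h1 + Complex.I * h2 -
      2 * (⟪w, A u⟫_ℂ - ⟪u, A w⟫_ℂ) * Complex.I_sq
  simpa using h3

/-- Cross terms of f(T) between K and Kᗮ vanish, so the measures of w + u and w - u integrate C_c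
functions alike and coincide. This treats an arbitrary E without first proving it unique. -/
theorem IsSpectralResolution.proj_mem_of_reduces (hT : IsSelfAdjoint T)
    {E : ProjectionValuedMeasure H} (hE : IsSpectralResolution T E) {K : Submodule ℂ H}
    (hK : IsClosed (K : Set H)) [K.HasOrthogonalProjection] (hr : Reduces T K) {B : Set ℝ}
    (hB : MeasurableSet B) {w : H} (hw : w ∈ K) : E.proj B w ∈ K := by
  refine apply_mem_of_inner_reflection hK (fun w hw u hu => ?_) hw
  have hmeas : E.measure (w + u) = E.measure (w - u) := by
    refine Measure.ext_of_integral_eq_on_compactlySupported fun f => ?_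
    have hf := continuous_ofReal_comp (map_continuous f)
    have hs := hasCompactSupport_ofReal_comp f.hasCompactSupport
    have h1 := hE _ hf hs (w + u)
    have h2 := hE _ hf hs (w - u)
    rw [integral_complex_ofReal] at h1 h2
    have h3 : ⟪u, funCalc T (fun x => (f x : ℂ)) w⟫_ℂ = 0 :=
      Submodule.inner_left_of_mem_orthogonal
        (apply_mem_of_commute_starProjection (hr.commute_funCalc hT _) hw) hu
    have h4 : ⟪w, funCalc T (fun x => (f x : ℂ)) u⟫_ℂ = 0 := by
      rw [← inner_conj_symm, inner_funCalc_star, star_ofReal_comp, h3, map_zero]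
    have h5 : ((∫ x, f x ∂(E.measure (w + u)) : ℝ) : ℂ) = (∫ x, f x ∂(E.measure (w - u)) : ℝ) := by
      rw [← h1, ← h2]
      simp only [map_add, map_sub, inner_add_left, inner_add_right, inner_sub_left,
        inner_sub_right, h3, h4]
      ring
    exact_mod_cast h5
  rw [E.inner_proj_self hB, E.inner_proj_self hB, hmeas]

/-- The same reflection argument in the other direction: vanishing cross terms of E give equal
measures, hence equal forms of f(T). -/
theorem IsSpectralResolution.funCalc_mem {E : ProjectionValuedMeasure H}
    (hE : IsSpectralResolution T E) {L : Submodule ℂ H} (hL : IsClosed (L : Set H))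
    (h : ∀ B, MeasurableSet B → ∀ w ∈ L, E.proj B w ∈ L) {f : ℝ → ℂ} (hf : Continuous f)
    (hc : HasCompactSupport f) {w : H} (hw : w ∈ L) : funCalc T f w ∈ L := by
  refine apply_mem_of_inner_reflection hL (fun w hw u hu => ?_) hw
  have hmeas : E.measure (w + u) = E.measure (w - u) := by
    ext B hB
    have h3 : ⟪u, E.proj B w⟫_ℂ = 0 := Submodule.inner_left_of_mem_orthogonal (h B hB w hw) hu
    have h4 : ⟪w, E.proj B u⟫_ℂ = 0 := by
      rw [← E.inner_proj_left hB]
      exact Submodule.inner_right_of_mem_orthogonal (h B hB w hw) hu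
    rw [E.measure_apply _ hB, E.measure_apply _ hB]
    simp only [map_add, map_sub, inner_add_left, inner_add_right, inner_sub_left,
      inner_sub_right, h3, h4]
    ring_nf
  rw [hE f hf hc, hE f hf hc, hmeas]

/-- The intervals contained in some interval of length `ε`. -/
def shortIntervals (ε : ℝ) : Set (Set ℝ) :=
  {Δ | Δ.OrdConnected ∧ ∃ a : ℝ, Δ ⊆ Set.Icc a (a + ε)}

theorem isPiSystem_shortIntervals (ε : ℝ) : IsPiSystem (shortIntervals ε) := by
  rintro A ⟨hA, a, ha⟩ B ⟨hB, -⟩ -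
  exact ⟨hA.inter hB, a, Set.inter_subset_left.trans ha⟩

theorem Ico_mem_shortIntervals {ε a b : ℝ} (h : b ≤ a + ε) : Set.Ico a b ∈ shortIntervals ε :=
  ⟨Set.ordConnected_Ico, a, Set.Ico_subset_Icc_self.trans (Set.Icc_subset_Icc_right h)⟩

theorem borel_eq_generateFrom_shortIntervals {ε : ℝ} (hε : 0 < ε) :
    (inferInstance : MeasurableSpace ℝ) = MeasurableSpace.generateFrom (shortIntervals ε) := by
  refine le_antisymm ?_ (MeasurableSpace.generateFrom_le fun Δ h => h.1.measurableSet)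
  rw [BorelSpace.measurable_eq (α := ℝ), borel_eq_generateFrom_Iio]
  refine MeasurableSpace.generateFrom_le ?_
  rintro _ ⟨a, rfl⟩
  have h : Set.Iio a = ⋃ n : ℕ, Set.Ico (a - (n + 1) * ε) (a - n * ε) := by
    ext x
    simp only [Set.mem_Iio, Set.mem_iUnion, Set.mem_Ico]
    constructor
    · intro hx
      have ht : 0 < (a - x) / ε := div_pos (sub_pos.2 hx) hε
      -- n + 1 is the ceiling of (a - x) / ε; the floor would fail at the open right endpoints.
      obtain ⟨n, hn⟩ := Nat.exists_eq_succ_of_ne_zero (Nat.ceil_pos.2 ht).ne'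
      refine ⟨n, ?_, ?_⟩
      · have h1 := Nat.le_ceil ((a - x) / ε)
        rw [hn, div_le_iff₀ hε] at h1
        push_cast at h1
        linarith
      · have h1 := Nat.lt_ceil.1 (hn ▸ Nat.lt_succ_self n)
        rw [lt_div_iff₀ hε] at h1
        linarith
    · rintro ⟨n, -, h⟩
      have : 0 ≤ n * ε := by positivity
      linarith
  rw [h]
  refine @MeasurableSet.iUnion _ _ (MeasurableSpace.generateFrom (shortIntervals ε)) _ _ fun n => ?_
  exact MeasurableSpace.measurableSet_generateFrom (Ico_mem_shortIntervals (by linarith))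

theorem ProjectionValuedMeasure.proj_add_proj_compl (E : ProjectionValuedMeasure H) {A : Set ℝ}
    (hA : MeasurableSet A) (w : H) : E.proj A w + E.proj Aᶜ w = w := by
  let S : ℕ → Set ℝ := fun n => if n = 0 then A else if n = 1 then Aᶜ else ∅
  have hS : ∀ n, MeasurableSet (S n) := fun n => by
    simp only [S]
    split_ifs
    exacts [hA, hA.compl, MeasurableSet.empty]
  have hd : Pairwise fun m n => Disjoint (S m) (S n) := fun m n hmn => by
    simp only [S]
    split_ifs <;> first
      | omega
      | exact disjoint_compl_right
      | exact disjoint_compl_left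
      | simp
  have hU : ⋃ n, S n = Set.univ := by
    refine Set.eq_univ_of_forall fun x => Set.mem_iUnion.2 ?_
    by_cases hx : x ∈ A
    · exact ⟨0, hx⟩
    · exact ⟨1, hx⟩
  have h1 := E.hasSum_proj S hS hd w
  rw [hU, E.proj_univ] at h1
  have h2 : HasSum (fun n => E.proj (S n) w) (∑ n ∈ Finset.range 2, E.proj (S n) w) :=
    hasSum_sum_of_ne_finset_zero fun n hn => by
      have h0 : S n = ∅ := by
        rw [Finset.mem_range, not_lt] at hn
        simp only [S]
        rw [if_neg (by omega), if_neg (by omega)]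
      simp only [h0, E.proj_empty, zero_apply]
  have h3 := h2.unique h1
  rw [Finset.sum_range_succ, Finset.sum_range_one] at h3
  exact h3

/-- A π-λ argument on the sets B with E(B)w ∈ L; countable unions use that L is closed. -/
theorem ProjectionValuedMeasure.proj_mem_of_shortIntervals (E : ProjectionValuedMeasure H) {ε : ℝ}
    (hε : 0 < ε) {L : Submodule ℂ H} (hL : IsClosed (L : Set H)) {w : H}
    (h : ∀ Δ ∈ shortIntervals ε, E.proj Δ w ∈ L) {B : Set ℝ} (hB : MeasurableSet B) :
    E.proj B w ∈ L := by
  have hunion : ∀ A : ℕ → Set ℝ, (∀ n, MeasurableSet (A n)) →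
      Pairwise (fun m n => Disjoint (A m) (A n)) → (∀ n, E.proj (A n) w ∈ L) →
      E.proj (⋃ n, A n) w ∈ L := fun A hA hd hm =>
    hL.mem_of_tendsto (E.hasSum_proj A hA hd w)
      (Eventually.of_forall fun s => L.sum_mem fun n _ => hm n)
  -- Complements need w itself, and ℝ is not a short interval; tiling it by countably many intervals
  -- of length ε recovers w = E(ℝ)w.
  have hw : w ∈ L := by
    let e : ℕ ≃ ℤ := Equiv.intEquivNat.symm
    have h1 := hunion (fun n => Set.Ico (e n • ε) ((e n + 1) • ε)) (fun n => measurableSet_Ico)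
      (fun m n hmn => Set.pairwise_disjoint_Ico_zsmul ε (e.injective.ne hmn))
      (fun n => h _ (Ico_mem_shortIntervals (by rw [add_smul, one_smul])))
    rw [e.surjective.iUnion_comp fun n : ℤ => Set.Ico (n • ε) ((n + 1) • ε),
      iUnion_Ico_zsmul hε, E.proj_univ] at h1
    exact h1
  have hcompl : ∀ A : Set ℝ, MeasurableSet A → E.proj A w ∈ L → E.proj Aᶜ w ∈ L := by
    intro A hA hm
    rw [← add_sub_cancel_left (E.proj A w) (E.proj Aᶜ w), E.proj_add_proj_compl hA]
    exact L.sub_mem hw hm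
  induction B, hB using MeasurableSpace.induction_on_inter
    (borel_eq_generateFrom_shortIntervals hε) (isPiSystem_shortIntervals ε) with
  | empty => rw [E.proj_empty]; exact L.zero_mem
  | basic Δ hΔ => exact h Δ hΔ
  | compl A hA hm => exact hcompl A hA hm
  | iUnion A hd hA hm => exact hunion A hA hd hm

/-- The closed orbit of a subspace is spanned by its projections for any class of Borel sets
that contains the short intervals. -/
theorem IsSpectralResolution.orbit_eq (hT : IsSelfAdjoint T) {E : ProjectionValuedMeasure H}
    (hE : IsSpectralResolution T E) (R : Submodule ℂ H) {p : Set ℝ → Prop}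
    (hp : ∀ Δ, p Δ → MeasurableSet Δ) {ε : ℝ} (hε : 0 < ε) (hps : ∀ Δ ∈ shortIntervals ε, p Δ) :
    orbit T (R : Set H) =
      (⨆ (Δ : Set ℝ) (_ : p Δ), R.map (E.proj Δ : H →ₗ[ℂ] H)).topologicalClosure := by
  set L := (⨆ (Δ : Set ℝ) (_ : p Δ), R.map (E.proj Δ : H →ₗ[ℂ] H)).topologicalClosure with hLdef
  have hL : IsClosed (L : Set H) := Submodule.isClosed_topologicalClosure _
  have hmem : ∀ w ∈ R, ∀ B, MeasurableSet B → E.proj B w ∈ L := fun w hw B hB =>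
    E.proj_mem_of_shortIntervals hε hL (fun Δ hΔ => Submodule.le_topologicalClosure _
      (Submodule.mem_iSup_of_mem Δ (Submodule.mem_iSup_of_mem (hps Δ hΔ) ⟨w, hw, rfl⟩))) hB
  refine le_antisymm ?_ ?_
  · have hinv : ∀ B, MeasurableSet B → ∀ x ∈ L, E.proj B x ∈ L := by
      intro B hB
      have h1 : L ≤ L.comap (E.proj B : H →ₗ[ℂ] H) := by
        refine Submodule.topologicalClosure_minimal _ (iSup₂_le fun Δ hΔ => ?_)
          (hL.preimage (E.proj B).continuous)
        rintro _ ⟨w, hw, rfl⟩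
        change E.proj B (E.proj Δ w) ∈ L
        -- E(B)E(Δ)w = E(B ∩ Δ)w, where B ∩ Δ need not satisfy p; `hmem` covers all Borel sets.
        rw [← mul_apply_eq_comp, ← E.proj_inter B Δ hB (hp Δ hΔ)]
        exact hmem w hw _ (hB.inter (hp Δ hΔ))
      exact fun x hx => h1 hx
    refine Submodule.topologicalClosure_minimal _ (Submodule.span_le.2 ?_) hL
    rintro _ ⟨f, hf, hc, w, hw, rfl⟩
    refine hE.funCalc_mem hL hinv hf hc ?_
    have h1 := hmem w hw _ MeasurableSet.univ
    rwa [E.proj_univ] at h1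
  · refine Submodule.topologicalClosure_minimal _ (iSup₂_le fun Δ hΔ => ?_) (isClosed_orbit T _)
    rintro _ ⟨w, hw, rfl⟩
    exact hE.proj_mem_of_reduces hT (isClosed_orbit T _) (reduces_orbit hT _) (hp Δ hΔ)
      (subset_orbit hT _ hw)

end SpectralResolution

/-! ### Pure point spectrum. -/

section PurePoint

variable {H : Type*} [NormedAddCommGroup H] [InnerProductSpace ℂ H] [CompleteSpace H]
  {T : H →ₗ.[ℂ] H}

omit [CompleteSpace H] in
theorem mem_eigenspace_iff_mem_graph {z : ℂ} {x : H} :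
    x ∈ eigenspace T z ↔ (x, z • x) ∈ T.graph := by
  rw [LinearPMap.mem_graph_iff]
  constructor
  · rintro ⟨hx, h⟩
    exact ⟨⟨x, hx⟩, rfl, h⟩
  · rintro ⟨⟨x', hx⟩, rfl, h⟩
    exact ⟨hx, h⟩

theorem isClosed_eigenspace (hT : IsSelfAdjoint T) (z : ℂ) :
    IsClosed (eigenspace T z : Set H) :=
  (isResolventAt_resolventOp hT (z := Complex.I) (by simp)).isClosed_eigenspace z

theorem topologicalClosure_eigenspace (hT : IsSelfAdjoint T) (z : ℂ) :
    (eigenspace T z).topologicalClosure = eigenspace T z :=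
  (isClosed_eigenspace hT z).submodule_topologicalClosure_eq

theorem eigenProj_mem (hT : IsSelfAdjoint T) (z : ℂ) (x : H) :
    eigenProj T z x ∈ eigenspace T z := by
  rw [← topologicalClosure_eigenspace hT z]
  exact Submodule.starProjection_apply_mem _ x

theorem eigenProj_eq_self {z : ℂ} {x : H} (hx : x ∈ eigenspace T z) : eigenProj T z x = x :=
  Submodule.starProjection_eq_self_iff.2 (Submodule.le_topologicalClosure _ hx)

theorem inner_eigenProj_left (T : H →ₗ.[ℂ] H) (z : ℂ) (x y : H) :
    ⟪eigenProj T z x, y⟫_ℂ = ⟪x, eigenProj T z y⟫_ℂ :=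
  Submodule.inner_starProjection_left_eq_right _ x y

theorem inner_eq_zero_of_mem_eigenspace (hT : IsSelfAdjoint T) {z w : ℂ} (hzw : z ≠ w) {x y : H}
    (hx : x ∈ eigenspace T z) (hy : y ∈ eigenspace T w) : ⟪x, y⟫_ℂ = 0 := by
  by_cases hx0 : x = 0
  · rw [hx0, inner_zero_left]
  rw [mem_eigenspace_iff_mem_graph] at hx hy
  have h1 := inner_eq_of_mem_graph hT hx hx
  rw [inner_smul_left, inner_smul_right] at h1
  have h2 := inner_eq_of_mem_graph hT hx hy
  -- `h1` gives that z is real when x ≠ 0.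
  rw [inner_smul_left, inner_smul_right, mul_right_cancel₀ (inner_self_ne_zero.2 hx0) h1] at h2
  by_contra h
  exact hzw (mul_right_cancel₀ h h2)

theorem eigenProj_eq_zero (hT : IsSelfAdjoint T) {z w : ℂ} (hzw : z ≠ w) {x : H}
    (hx : x ∈ eigenspace T z) : eigenProj T w x = 0 := by
  rw [← inner_self_eq_zero (𝕜 := ℂ), inner_eigenProj_left, eigenProj_eq_self (eigenProj_mem hT w x)]
  exact inner_eq_zero_of_mem_eigenspace hT hzw hx (eigenProj_mem hT w x)

theorem HasPurePointSpectrum.eq_zero (h : HasPurePointSpectrum T) {x : H}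
    (hx : ∀ z, eigenProj T z x = 0) : x = 0 := by
  have h1 : (⨆ z, eigenspace T z).topologicalClosure ≤ (Submodule.span ℂ {x})ᗮ := by
    refine Submodule.topologicalClosure_minimal _ (iSup_le fun z e he => ?_)
      (Submodule.isClosed_orthogonal _)
    rw [Submodule.mem_orthogonal_singleton_iff_inner_left, ← eigenProj_eq_self he,
      inner_eigenProj_left, hx, inner_zero_right]
  rw [h] at h1
  have h2 := h1 (Submodule.mem_top (x := x))
  rwa [Submodule.mem_orthogonal_singleton_iff_inner_left, inner_self_eq_zero] at h2

/-- The projection onto K preserves the graph, hence each eigenspace, so the two projections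
commute. -/
theorem Reduces.eigenProj_mem (hT : IsSelfAdjoint T) {K : Submodule ℂ H}
    [K.HasOrthogonalProjection] (hr : Reduces T K) (z : ℂ) {w : H} (hw : w ∈ K) :
    eigenProj T z w ∈ K := by
  have h1 : ∀ x ∈ (eigenspace T z).topologicalClosure,
      K.starProjection x ∈ (eigenspace T z).topologicalClosure := by
    rw [topologicalClosure_eigenspace hT]
    intro x hx
    rw [mem_eigenspace_iff_mem_graph] at hx ⊢
    have h2 := hr _ _ hx
    rwa [map_smul] at h2
  refine apply_mem_of_commute_starProjection (K := K) ?_ hw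
  refine (commute_starProjection_of_invariant h1 ?_).symm
  rwa [(isSelfAdjoint_starProjection K).star_eq]

theorem orbit_eq_of_hasPurePointSpectrum (hT : IsSelfAdjoint T) (h : HasPurePointSpectrum T)
    (R : Submodule ℂ H) : orbit T (R : Set H) =
      (⨆ z : ℂ, R.map (eigenProj T z : H →ₗ[ℂ] H)).topologicalClosure := by
  set L := (⨆ z : ℂ, R.map (eigenProj T z : H →ₗ[ℂ] H)).topologicalClosure
  have hL : IsClosed (L : Set H) := Submodule.isClosed_topologicalClosure _
  have hLc : CompleteSpace L := hL.completeSpace_coe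
  have hmem : ∀ z, ∀ w ∈ R, eigenProj T z w ∈ L := fun z w hw =>
    Submodule.le_topologicalClosure _ (Submodule.mem_iSup_of_mem z ⟨w, hw, rfl⟩)
  have hinv : ∀ A : H →L[ℂ] H, (∀ z, ∀ w ∈ R, A (eigenProj T z w) ∈ L) → ∀ x ∈ L, A x ∈ L := by
    intro A hA
    have h1 : L ≤ L.comap (A : H →ₗ[ℂ] H) := by
      refine Submodule.topologicalClosure_minimal _ (iSup_le fun z => ?_) (hL.preimage A.continuous)
      rintro _ ⟨w, hw, rfl⟩
      exact hA z w hw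
    exact fun x hx => h1 hx
  refine le_antisymm (orbit_le hT hL ?_ fun w hw => ?_) ?_
  · have hres : ∀ ζ : ℂ, ζ.im ≠ 0 → ∀ x ∈ L, resolventOp T ζ x ∈ L := fun ζ hζ =>
      hinv _ fun z w hw => by
        rw [(isResolventAt_resolventOp hT hζ).apply_of_mem_eigenspace (eigenProj_mem hT z w)]
        exact L.smul_mem _ (hmem z w hw)
    rw [reduces_iff_commute hT]
    refine commute_starProjection_of_invariant (hres _ (by simp)) ?_
    rw [star_resolventOp_I hT]
    exact hres _ (by simp)
  · have hP : ∀ z, ∀ x ∈ L, eigenProj T z x ∈ L := fun z => hinv _ fun z' w hw => by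
      by_cases hz : z' = z
      · rw [hz, eigenProj_eq_self (eigenProj_mem hT z w)]
        exact hmem z w hw
      · rw [eigenProj_eq_zero hT hz (eigenProj_mem hT z' w)]
        exact L.zero_mem
    -- Each eigenprojection of this difference lies in L, yet the difference is orthogonal to L; so
    -- all its eigenprojections vanish.
    have h0 : w - L.starProjection w = 0 := by
      refine h.eq_zero fun z => ?_
      have h1 : eigenProj T z (w - L.starProjection w) ∈ L := by
        rw [map_sub]
        exact L.sub_mem (hmem z w hw) (hP z _ (L.starProjection_apply_mem w))
      have h2 := Submodule.inner_right_of_mem_orthogonal (hP z _ h1)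
        (L.sub_starProjection_mem_orthogonal w)
      rwa [inner_eigenProj_left, inner_self_eq_zero] at h2
    exact Submodule.starProjection_eq_self_iff.1 (sub_eq_zero.1 h0).symm
  · refine Submodule.topologicalClosure_minimal _ (iSup_le fun z => ?_) (isClosed_orbit T _)
    rintro _ ⟨w, hw, rfl⟩
    exact (reduces_orbit hT _).eigenProj_mem hT z (subset_orbit hT _ hw)

theorem isOrtho_map_eigenProj (hT : IsSelfAdjoint T) (R : Submodule ℂ H) {z w : ℂ} (hzw : z ≠ w) :
    R.map (eigenProj T z : H →ₗ[ℂ] H) ⟂ R.map (eigenProj T w : H →ₗ[ℂ] H) := by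
  rw [Submodule.isOrtho_iff_inner_eq]
  rintro _ ⟨x, -, rfl⟩ _ ⟨y, -, rfl⟩
  exact inner_eq_zero_of_mem_eigenspace hT hzw (eigenProj_mem hT z x) (eigenProj_mem hT w y)

/-- If `T` has pure point spectrum, the closed orbit of the range of an operator is everything if
and only if the adjoint operator kills no eigenmode. -/
theorem orbit_range_adjoint_eq_top_iff (hT : IsSelfAdjoint T) (h : HasPurePointSpectrum T)
    {G : Type*} [NormedAddCommGroup G] [InnerProductSpace ℂ G] [CompleteSpace G] (Γ : H →L[ℂ] G) :
    orbit T ((ContinuousLinearMap.adjoint Γ).range : Set H) = ⊤ ↔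
      ∀ φ : H, IsEigenmode T φ → Γ φ ≠ 0 := by
  constructor
  · rintro htop φ ⟨hφ0, z, hφ⟩ h0
    have h1 : orbit T ((ContinuousLinearMap.adjoint Γ).range : Set H) ≤ (Submodule.span ℂ {φ})ᗮ := by
      rw [orbit_eq_of_hasPurePointSpectrum hT h]
      refine Submodule.topologicalClosure_minimal _ (iSup_le fun w => ?_)
        (Submodule.isClosed_orthogonal _)
      rintro _ ⟨_, ⟨y, rfl⟩, rfl⟩
      rw [Submodule.mem_orthogonal_singleton_iff_inner_right]
      change ⟪φ, eigenProj T w (ContinuousLinearMap.adjoint Γ y)⟫_ℂ = 0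
      -- Moving the projection onto φ leaves φ or 0, and Γφ = 0 makes φ orthogonal to Ran Γ†.
      rw [← inner_eigenProj_left]
      by_cases hzw : z = w
      · rw [← hzw, eigenProj_eq_self hφ, ContinuousLinearMap.adjoint_inner_right, h0,
          inner_zero_left]
      · rw [eigenProj_eq_zero hT hzw hφ, inner_zero_left]
    rw [htop] at h1
    have h2 := h1 (Submodule.mem_top (x := φ))
    rw [Submodule.mem_orthogonal_singleton_iff_inner_right, inner_self_eq_zero] at h2
    exact hφ0 h2
  · intro hΓ
    set K := orbit T ((ContinuousLinearMap.adjoint Γ).range : Set H)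
    have hr : Reduces T K := reduces_orbit hT _
    rw [← Submodule.orthogonal_eq_bot_iff, Submodule.eq_bot_iff]
    intro u hu
    -- With P the eigenprojection, ‖ΓPu‖² = ⟪PΓ†ΓPu, u⟫ = 0, since PΓ†ΓPu lies in the orbit and u is
    -- orthogonal to it.
    refine h.eq_zero fun z => by_contra fun hne => hΓ _ ⟨hne, z, eigenProj_mem hT z u⟩ ?_
    rw [← inner_self_eq_zero (𝕜 := ℂ), ← ContinuousLinearMap.adjoint_inner_left,
      ← inner_eigenProj_left]
    exact Submodule.inner_right_of_mem_orthogonal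
      (hr.eigenProj_mem hT z (subset_orbit hT _ ⟨_, rfl⟩)) hu

end PurePoint

end OpenSystem

/-! ### The spectral representation of the hidden variables. -/

theorem mainTheorem6 {H : Type*} [NormedAddCommGroup H] [InnerProductSpace ℂ H] [CompleteSpace H]
    (Ω : H →ₗ.[ℂ] H) (hΩ : IsSelfAdjoint Ω)
    (H₁ : Submodule ℂ H) [CompleteSpace H₁]
    (Γ : H₁ᗮ →L[ℂ] H₁) (hΓ : OpenSystem.HasBoundedCoupling Ω H₁ Γ)
    (Ω₂ : H₁ᗮ →ₗ.[ℂ] H₁ᗮ) (hΩ₂ : Ω₂ = OpenSystem.compression Ω H₁ᗮ)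
    (R : Submodule ℂ H₁ᗮ) (hR : R = (ContinuousLinearMap.adjoint Γ).range) :
    -- pure point spectrum: projections onto the eigenspaces
    (OpenSystem.HasPurePointSpectrum Ω₂ →
      OpenSystem.coupledComponent Ω H₁ = OpenSystem.orbit Ω₂ (R : Set H₁ᗮ) ∧
      OpenSystem.orbit Ω₂ (R : Set H₁ᗮ) =
        (⨆ z : ℂ, R.map (OpenSystem.eigenProj Ω₂ z : H₁ᗮ →ₗ[ℂ] H₁ᗮ)).topologicalClosure ∧
      Pairwise (fun z w : ℂ => R.map (OpenSystem.eigenProj Ω₂ z : H₁ᗮ →ₗ[ℂ] H₁ᗮ) ⟂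
        R.map (OpenSystem.eigenProj Ω₂ w : H₁ᗮ →ₗ[ℂ] H₁ᗮ))) ∧
    -- general spectrum: spectral projections of intervals
    ((∃ E : OpenSystem.ProjectionValuedMeasure H₁ᗮ, OpenSystem.IsSpectralResolution Ω₂ E) ∧
      ∀ E : OpenSystem.ProjectionValuedMeasure H₁ᗮ, OpenSystem.IsSpectralResolution Ω₂ E →
        OpenSystem.coupledComponent Ω H₁ =
          (⨆ (Δ : Set ℝ) (_ : Δ.OrdConnected),
            R.map (E.proj Δ : H₁ᗮ →ₗ[ℂ] H₁ᗮ)).topologicalClosure ∧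
        ∀ ε : ℝ, 0 < ε →
          OpenSystem.coupledComponent Ω H₁ =
            (⨆ (Δ : Set ℝ) (_ : Δ.OrdConnected ∧ ∃ a : ℝ, Δ ⊆ Set.Icc a (a + ε)),
              R.map (E.proj Δ : H₁ᗮ →ₗ[ℂ] H₁ᗮ)).topologicalClosure) ∧
    -- pure point spectrum: criterion for all hidden variables to be coupled
    (OpenSystem.HasPurePointSpectrum Ω₂ →
      (OpenSystem.coupledComponent Ω H₁ = ⊤ ↔
        ∀ φ : H₁ᗮ, OpenSystem.IsEigenmode Ω₂ φ → Γ φ ≠ 0))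
 := by
  subst hΩ₂ hR
  have hT := hΓ.isSelfAdjoint_compression hΩ
  rw [hΓ.coupledComponent_eq hΩ]
  refine ⟨fun hp => ⟨rfl, OpenSystem.orbit_eq_of_hasPurePointSpectrum hT hp _,
      fun z w hzw => OpenSystem.isOrtho_map_eigenProj hT _ hzw⟩,
    ⟨⟨_, OpenSystem.isSpectralResolution_spectralResolution hT⟩, fun E hE => ⟨?_, fun ε hε => ?_⟩⟩,
    fun hp => OpenSystem.orbit_range_adjoint_eq_top_iff hT hp Γ⟩
  -- The length 1 is arbitrary: all intervals include the short ones of any length.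
  · exact hE.orbit_eq hT _ (fun Δ hΔ => hΔ.measurableSet) one_pos fun Δ hΔ => hΔ.1
  · exact hE.orbit_eq hT _ (fun Δ hΔ => hΔ.1.measurableSet) hε fun Δ hΔ => hΔ
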